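/- Let $(M,g)$ be a smooth pseudo-Riemannian manifold of dimension $n\ge 2$ (of arbitrary signature), with Levi-Civita connection $\nabla$, curvature tensor $R(X,Y)Z=\nabla_X\nabla_YZ-\nabla_Y\nabla_XZ-\nabla_{[X,Y]}Z$, Laplace–Beltrami operator $\Delta_M$ (the trace of the Hessian $\nabla d$, so $\Delta_{\mathbb R^n}=\sum_i\partial^2/\partial x_i^2$ for the standard Riemannian metric) and scalar curvature $$K_M(x)=\sum_{i,j=1}^n\varepsilon_i\varepsilon_j\,g\big(R(X_i,X_j)X_j,X_i\big),$$ where $X_1,\dots,X_n$ is a basis of $T_xM$ with $g(X_i,X_j)=\varepsilon_i\delta_{ij}$, $\varepsilon_i=\pm1$ (so $K_{S^n}=n(n-1)$ for the unit sphere). The Yamabe operator is $\widetilde\Delta_M=\Delta_M-\frac{n-2}{4(n-1)}K_M$, acting on the space $C^\infty(M)$ of smooth complex-valued functions. Let a group $G$ act on $M$ by smooth maps $L_h\colon M\to M$ $(h\in G)$, conformally: for every $h\in G$ there is a positive function $\Omega(h,\cdot)$ on $M$ with $L_h^*g=\Omega(h,\cdot)^2g$. For $\lambda\in\mathbb C$,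 $h\in G$, $f\in C^\infty(M)$ and $x\in M$ put $$(\varpi_\lambda(h^{-1})f)(x)=\Omega(h,x)^\lambda f(L_hx).$$ Then, for every $\lambda\in\mathbb C$, $\varpi_\lambda$ is a representation of $G$ on $C^\infty(M)$, and: 1. $\widetilde\Delta_M$ is a linear map $C^\infty(M)\to C^\infty(M)$ which intertwines $\varpi_{\frac{n-2}2}$ and $\varpi_{\frac{n+2}2}$, that is, $\widetilde\Delta_M\,\varpi_{\frac{n-2}2}(h)=\varpi_{\frac{n+2}2}(h)\,\widetilde\Delta_M$ for all $h\in G$. 2. The kernel $\operatorname{Ker}\widetilde\Delta_M\subseteq C^\infty(M)$ is a subrepresentation of $\varpi_{\frac{n-2}2}$. -/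

import Mathlib

/-!
In charts everything becomes a statement about metrics on open subsets of a vector space. The
scalar curvature and the Laplacian are natural under isometries; applied to changes of charts, this
shows that the Yamabe operator of a manifold may be computed in any chart. A conformal map `Φ` with
factor `Ω = e ^ σ` is an isometry from `Ω ^ 2 g` to `g`, so it remains to compare the Yamabe
operators of `g` and of `e ^ (2 σ) g` on one open set.

The difference of their Levi-Civita connections is algebraic in `dσ`, and differentiating it shows
that the curvature changes by the Kulkarni-Nomizu product of `g` with
`A = ∇dσ - dσ ⊗ dσ + |dσ|² g / 2`. Contracting twice,
`K' = e ^ (-2 σ) (K - 2 (n - 1) tr A)`, while `Δ' f = e ^ (-2 σ) (Δ f + (n - 2) df(∇σ))`. With the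
weight `w = e ^ ((n - 2) / 2 σ)` the same first-order term appears in
`Δ (w f) = w (Δ f + (n - 2) df(∇σ) + (n - 2) / 2 (tr A) f)`, and the remaining term is exactly the
change of the scalar curvature with coefficient `(n - 2) / (4 (n - 1))`.

The conformal factor of a map is determined by the metric, so it is smooth and satisfies the cocycle
identity, which makes the twisted operators a representation.
-/

open scoped Manifold ContDiff Bundle

noncomputable section

/-! ### Pseudo-Riemannian metrics and conformal maps -/

/-- A smooth pseudo-Riemannian metric on a manifold `M` without boundary, modelled on the
finite-dimensional real vector space `E`: a smooth field of nondegenerate symmetric bilinear forms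
on the tangent spaces. -/
structure PseudoRiemannianMetric (E : Type*) [NormedAddCommGroup E] [NormedSpace ℝ E]
    (M : Type*) [TopologicalSpace M] [ChartedSpace E M] [IsManifold 𝓘(ℝ, E) ∞ M] where
  val (x : M) : TangentSpace 𝓘(ℝ, E) x →L[ℝ] TangentSpace 𝓘(ℝ, E) x →L[ℝ] ℝ
  symm (x : M) (u v : TangentSpace 𝓘(ℝ, E) x) : val x u v = val x v u
  nondegenerate (x : M) (u : TangentSpace 𝓘(ℝ, E) x) : (∀ v, val x u v = 0) → u = 0
  contMDiff : ContMDiff 𝓘(ℝ, E) (𝓘(ℝ, E).prod 𝓘(ℝ, E →L[ℝ] E →L[ℝ] ℝ)) ∞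
    (fun x : M ↦ Bundle.TotalSpace.mk' (E →L[ℝ] E →L[ℝ] ℝ)
      (E := fun x : M ↦ TangentSpace 𝓘(ℝ, E) x →L[ℝ] TangentSpace 𝓘(ℝ, E) x →L[ℝ] ℝ) x (val x))

/-- `Ω` is a positive function with `Φ^* g = Ω ^ 2 g`. -/
def IsConformalFactor {E : Type*} [NormedAddCommGroup E] [NormedSpace ℝ E]
    {M : Type*} [TopologicalSpace M] [ChartedSpace E M] [IsManifold 𝓘(ℝ, E) ∞ M]
    (g : PseudoRiemannianMetric E M) (Φ : M → M) (Ω : M → ℝ) : Prop :=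
  (∀ x, 0 < Ω x) ∧
    ∀ (x : M) (u v : TangentSpace 𝓘(ℝ, E) x),
      g.val (Φ x) (mfderiv 𝓘(ℝ, E) 𝓘(ℝ, E) Φ x u) (mfderiv 𝓘(ℝ, E) 𝓘(ℝ, E) Φ x v) =
        Ω x ^ 2 * g.val x u v

/-! ### Levi-Civita connection, curvature and Laplacian of a metric on an open subset of `E`

In this section `G : E → E →L[ℝ] E →L[ℝ] ℝ` is a pseudo-Riemannian metric near the point `y : E`
under consideration. -/

namespace LocalMetric

variable {E : Type*} [NormedAddCommGroup E] [NormedSpace ℝ E]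

/-- The isomorphism from covectors to vectors: `G y (sharp G y α) = α`. -/
def sharp (G : E → E →L[ℝ] E →L[ℝ] ℝ) (y : E) : (E →L[ℝ] ℝ) →L[ℝ] E :=
  ContinuousLinearMap.inverse (G y)

/-- The covector `w ↦ (∂_u G(v, w) + ∂_v G(u, w) - ∂_w G(u, v)) / 2` of the Koszul formula
for the constant vector fields `u`, `v`, `w`. -/
def koszul (G : E → E →L[ℝ] E →L[ℝ] ℝ) (y : E) (u v : E) : E →L[ℝ] ℝ :=
  (1 / 2 : ℝ) • (fderiv ℝ G y u v + fderiv ℝ G y v u - ((fderiv ℝ G y).flip u).flip v)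

/-- The Christoffel symbols: `christoffel G y u v` is `∇_u v` at `y` for the constant vector
fields `u` and `v`. -/
def christoffel (G : E → E →L[ℝ] E →L[ℝ] ℝ) (y : E) (u v : E) : E :=
  sharp G y (koszul G y u v)

/-- The Levi-Civita covariant derivative `∇_X Z` of vector fields. -/
def cov (G : E → E →L[ℝ] E →L[ℝ] ℝ) (X Z : E → E) (y : E) : E :=
  fderiv ℝ Z y (X y) + christoffel G y (X y) (Z y)

/-- The curvature `R(X, Y) Z = ∇_X ∇_Y Z - ∇_Y ∇_X Z - ∇_[X, Y] Z`. -/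
def curvature (G : E → E →L[ℝ] E →L[ℝ] ℝ) (X Y Z : E → E) (y : E) : E :=
  cov G X (cov G Y Z) y - cov G Y (cov G X Z) y - cov G (VectorField.lieBracket ℝ X Y) Z y

variable [FiniteDimensional ℝ E]

/-- The `i`-th coordinate covector of the basis `Module.finBasis ℝ E` of `E`. -/
def coord (i : Fin (Module.finrank ℝ E)) : E →L[ℝ] ℝ :=
  LinearMap.toContinuousLinearMap ((Module.finBasis ℝ E).coord i)

/-- The scalar curvature `∑ i, ∑ j, G(R(b_i, b_j) b^j, b^i)`, where `b` is a basis of `E` and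
`b^i = sharp (coord i)` is the dual basis with respect to `G y`. It does not depend on `b`; for an
orthonormal basis, `G(b_i, b_j) = ε_i δ_ij` with `ε_i = ± 1`, one has `b^i = ε_i b_i` and it is
`∑ i, ∑ j, ε_i ε_j G(R(b_i, b_j) b_j, b_i)`, which is `n (n - 1)` for the unit sphere. -/
def scalarCurvature (G : E → E →L[ℝ] E →L[ℝ] ℝ) (y : E) : ℝ :=
  ∑ i, ∑ j, G y
    (curvature G (fun _ ↦ Module.finBasis ℝ E i) (fun _ ↦ Module.finBasis ℝ E j)
      (fun _ ↦ sharp G y (coord j)) y)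
    (sharp G y (coord i))

/-- The Hessian `(∇ df)(u, v) = u (v f) - (∇_u v) f` (for constant `u`, `v`) of a complex-valued
function. -/
def hessian (G : E → E →L[ℝ] E →L[ℝ] ℝ) (f : E → ℂ) (y : E) (u v : E) : ℂ :=
  fderiv ℝ (fderiv ℝ f) y u v - fderiv ℝ f y (christoffel G y u v)

/-- The Laplace-Beltrami operator: the trace `∑ i, (∇ df)(b_i, b^i)` of the Hessian with respect to
`G`. It does not depend on the basis `b`. -/
def laplacian (G : E → E →L[ℝ] E →L[ℝ] ℝ) (f : E → ℂ) (y : E) : ℂ :=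
  ∑ i, hessian G f y (Module.finBasis ℝ E i) (sharp G y (coord i))

end LocalMetric

/-! ### The Yamabe operator of a pseudo-Riemannian manifold -/

namespace PseudoRiemannianMetric

variable {E : Type*} [NormedAddCommGroup E] [NormedSpace ℝ E]
  {M : Type*} [TopologicalSpace M] [ChartedSpace E M] [IsManifold 𝓘(ℝ, E) ∞ M]

/-- The metric `g` read in a chart `e`, that is, the pullback of `g` under `e.symm`. -/
def inChart (g : PseudoRiemannianMetric E M) (e : OpenPartialHomeomorph M E) (y : E) :
    E →L[ℝ] E →L[ℝ] ℝ :=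
  ContinuousLinearMap.bilinearComp (E := E) (F := E) (E' := E) (F' := E) (g.val (e.symm y))
    (mfderiv 𝓘(ℝ, E) 𝓘(ℝ, E) e.symm y) (mfderiv 𝓘(ℝ, E) 𝓘(ℝ, E) e.symm y)

variable [FiniteDimensional ℝ E]

/-- The scalar curvature `K_M`, computed at each point `x` in the preferred chart at `x`. -/
def scalarCurvature (g : PseudoRiemannianMetric E M) (x : M) : ℝ :=
  LocalMetric.scalarCurvature (g.inChart (chartAt E x)) (chartAt E x x)

/-- The Laplace-Beltrami operator `Δ_M`, computed at each point `x` in the preferred chart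
at `x`. -/
def laplacian (g : PseudoRiemannianMetric E M) (f : M → ℂ) (x : M) : ℂ :=
  LocalMetric.laplacian (g.inChart (chartAt E x)) (f ∘ (chartAt E x).symm) (chartAt E x x)

/-- The Yamabe operator `Δ_M - (n - 2) / (4 (n - 1)) K_M`, `n = dim M`. -/
def yamabe (g : PseudoRiemannianMetric E M) (f : M → ℂ) (x : M) : ℂ :=
  g.laplacian f x -
    ((Module.finrank ℝ E : ℂ) - 2) / (4 * ((Module.finrank ℝ E : ℂ) - 1)) *
      (g.scalarCurvature x : ℂ) * f x

end PseudoRiemannianMetric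

/-- The complex vector space `C^∞(M)` of smooth complex-valued functions on `M`. -/
def SmoothFunctions (E : Type*) [NormedAddCommGroup E] [NormedSpace ℝ E]
    (M : Type*) [TopologicalSpace M] [ChartedSpace E M] : Submodule ℂ (M → ℂ) where
  carrier := {f | ContMDiff 𝓘(ℝ, E) 𝓘(ℝ, ℂ) ∞ f}
  add_mem' hf hg := ContMDiff.add hf hg
  zero_mem' := contMDiff_const
  smul_mem' c f hf := by
    have h : ContMDiff 𝓘(ℝ, E) 𝓘(ℝ, ℂ) ∞ (fun x ↦ c * f x) :=
      ContMDiff.comp (I' := 𝓘(ℝ, ℂ)) (g := fun z : ℂ ↦ c * z)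
        (ContDiff.contMDiff (contDiff_const.mul contDiff_id)) hf
    exact h

end

set_option maxSynthPendingDepth 3

noncomputable section

/-! ### Christoffel symbols and curvature as multilinear maps -/

namespace LocalMetric

section Calculus

variable {E F : Type*} [NormedAddCommGroup E] [NormedSpace ℝ E]
  [NormedAddCommGroup F] [NormedSpace ℝ F] {y : E}

lemma fderiv_apply_apply {A : E → E →L[ℝ] E →L[ℝ] F} (hA : DifferentiableAt ℝ A y) (u v w : E) :
    fderiv ℝ A y u v w = fderiv ℝ (fun z ↦ A z v w) y u := by
  rw [fderiv_clm_apply (hA.clm_apply (differentiableAt_const v)) (differentiableAt_const w),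
    fderiv_clm_apply hA (differentiableAt_const v)]
  simp

lemma differentiableAt_fderiv {f : E → F} (hf : ContDiffAt ℝ 2 f y) :
    DifferentiableAt ℝ (fderiv ℝ f) y :=
  (hf.fderiv_right (m := 1) (by norm_num)).differentiableAt (by simp)

lemma fderiv_fderiv_apply {f : E → F} (hf : ContDiffAt ℝ 2 f y) (u v : E) :
    fderiv ℝ (fun z ↦ fderiv ℝ f z v) y u = fderiv ℝ (fderiv ℝ f) y u v := by
  rw [fderiv_clm_apply (differentiableAt_fderiv hf) (differentiableAt_const v)]
  simp

lemma eventually_differentiableAt {f : E → F} (hf : ContDiffAt ℝ 2 f y) :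
    ∀ᶠ z in nhds y, DifferentiableAt ℝ f z := by
  filter_upwards [hf.eventually (by simp)] with z hz using hz.differentiableAt (by simp)

lemma fderiv_fderiv_comm {f : E → F} (hf : ContDiffAt ℝ 2 f y) (u v : E) :
    fderiv ℝ (fderiv ℝ f) y u v = fderiv ℝ (fderiv ℝ f) y v u :=
  hf.isSymmSndFDerivAt (by simp) u v

end Calculus

variable {E : Type*} [NormedAddCommGroup E] [NormedSpace ℝ E]

/-- `G` is a smooth pseudo-Riemannian metric on the open subset `U` of `E`. -/
structure IsMetricOn (G : E → E →L[ℝ] E →L[ℝ] ℝ) (U : Set E) : Prop where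
  isOpen : IsOpen U
  contDiffOn : ContDiffOn ℝ ∞ G U
  symm : ∀ y ∈ U, ∀ u v, G y u v = G y v u
  nondegenerate : ∀ y ∈ U, ∀ u, (∀ v, G y u v = 0) → u = 0

/-- The Koszul covectors `koszul G y u v` as a bilinear map in `u` and `v`. -/
def koszulForm (G : E → E →L[ℝ] E →L[ℝ] ℝ) (y : E) : E →L[ℝ] E →L[ℝ] E →L[ℝ] ℝ :=
  (1 / 2 : ℝ) • (fderiv ℝ G y + (fderiv ℝ G y).flip -
    ((ContinuousLinearMap.flipₗᵢ ℝ E E ℝ).toContinuousLinearEquiv :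
      (E →L[ℝ] E →L[ℝ] ℝ) →L[ℝ] (E →L[ℝ] E →L[ℝ] ℝ)).comp (fderiv ℝ G y).flip)

/-- The Christoffel symbols `christoffel G y u v` as a bilinear map in `u` and `v`. -/
def christoffelForm (G : E → E →L[ℝ] E →L[ℝ] ℝ) (y : E) : E →L[ℝ] E →L[ℝ] E :=
  (ContinuousLinearMap.compL ℝ E (E →L[ℝ] ℝ) E (sharp G y)).comp (koszulForm G y)

/-- The second covariant derivative `∇_u ∇_v w` of constant vector fields. -/
def secondCov (G : E → E →L[ℝ] E →L[ℝ] ℝ) (y : E) : E →L[ℝ] E →L[ℝ] E →L[ℝ] E :=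
  fderiv ℝ (christoffelForm G) y +
    (ContinuousLinearMap.compL ℝ E E E).bilinearComp (christoffelForm G y) (christoffelForm G y)

/-- The curvature tensor `R(u, v) w` as a trilinear map, in terms of the Christoffel symbols and
their derivatives. -/
def curvatureForm (G : E → E →L[ℝ] E →L[ℝ] ℝ) (y : E) : E →L[ℝ] E →L[ℝ] E →L[ℝ] E :=
  secondCov G y - (secondCov G y).flip

variable {G : E → E →L[ℝ] E →L[ℝ] ℝ} {U : Set E} {y : E}

lemma christoffelForm_apply (u v : E) : christoffelForm G y u v = christoffel G y u v := rfl

lemma koszul_apply (u v w : E) :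
    koszul G y u v w =
      (fderiv ℝ G y u v w + fderiv ℝ G y v u w - fderiv ℝ G y w u v) / 2 := by
  simp only [koszul, smul_apply, sub_apply,
    add_apply, ContinuousLinearMap.flip_apply, smul_eq_mul]
  ring

lemma curvatureForm_apply (u v w : E) :
    curvatureForm G y u v w =
      fderiv ℝ (christoffelForm G) y u v w - fderiv ℝ (christoffelForm G) y v u w
        + christoffelForm G y u (christoffelForm G y v w)
        - christoffelForm G y v (christoffelForm G y u w) := by
  simp only [curvatureForm, secondCov, sub_apply,
    add_apply, ContinuousLinearMap.flip_apply,
    ContinuousLinearMap.bilinearComp_apply, ContinuousLinearMap.compL_apply,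
    ContinuousLinearMap.comp_apply]
  abel

lemma cov_const (u v : E) :
    cov G (fun _ ↦ u) (fun _ ↦ v) = fun z ↦ christoffelForm G z u v := by
  ext z
  simp [cov, christoffelForm_apply]

lemma curvature_const (h : DifferentiableAt ℝ (christoffelForm G) y) (u v w : E) :
    curvature G (fun _ ↦ u) (fun _ ↦ v) (fun _ ↦ w) y = curvatureForm G y u v w := by
  have hbracket : VectorField.lieBracket ℝ (fun _ : E ↦ u) (fun _ : E ↦ v) = fun _ ↦ 0 := by
    ext; simp [VectorField.lieBracket]
  simp only [curvature, hbracket, cov_const, curvatureForm_apply, map_zero,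
    zero_apply, cov, ← christoffelForm_apply, ← fderiv_apply_apply h, fderiv_fun_const,
    Pi.zero_apply, zero_add]
  abel

namespace IsMetricOn

lemma contDiffAt (hG : IsMetricOn G U) (hy : y ∈ U) : ContDiffAt ℝ ∞ G y :=
  hG.contDiffOn.contDiffAt (hG.isOpen.mem_nhds hy)

lemma differentiableAt (hG : IsMetricOn G U) (hy : y ∈ U) : DifferentiableAt ℝ G y :=
  (hG.contDiffAt hy).differentiableAt (by simp)

lemma mono (hG : IsMetricOn G U) {V : Set E} (hV : IsOpen V) (h : V ⊆ U) : IsMetricOn G V :=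
  ⟨hV, hG.contDiffOn.mono h, fun y hy ↦ hG.symm y (h hy), fun y hy ↦ hG.nondegenerate y (h hy)⟩

lemma fderiv_symm (hG : IsMetricOn G U) (hy : y ∈ U) (u v w : E) :
    fderiv ℝ G y u v w = fderiv ℝ G y u w v := by
  rw [fderiv_apply_apply (hG.differentiableAt hy), fderiv_apply_apply (hG.differentiableAt hy)]
  congr 1
  apply Filter.EventuallyEq.fderiv_eq
  filter_upwards [hG.isOpen.mem_nhds hy] with z hz using hG.symm z hz v w

lemma eq_of_forall_apply_eq (hG : IsMetricOn G U) (hy : y ∈ U) {u v : E}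
    (h : ∀ w, G y u w = G y v w) : u = v := by
  refine sub_eq_zero.1 (hG.nondegenerate y hy _ fun w ↦ ?_)
  simp [h w]

lemma contDiffOn_pullback_apply (hG : IsMetricOn G U) {φ : E → E} {V : Set E} (hV : IsOpen V)
    (hφ : ContDiffOn ℝ ∞ φ V) (hVU : Set.MapsTo φ V U) (u v : E) :
    ContDiffOn ℝ ∞ (fun y ↦ G (φ y) (fderiv ℝ φ y u) (fderiv ℝ φ y v)) V := by
  have hφ' : ContDiffOn ℝ ∞ (fderiv ℝ φ) V := hφ.fderiv_of_isOpen hV (by simp)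
  exact ((hG.contDiffOn.comp hφ hVU).clm_apply (hφ'.clm_apply contDiffOn_const)).clm_apply
    (hφ'.clm_apply contDiffOn_const)

variable [FiniteDimensional ℝ E]

lemma isInvertible (hG : IsMetricOn G U) (hy : y ∈ U) : (G y).IsInvertible := by
  have hinj : Function.Injective (G y : E →ₗ[ℝ] (E →L[ℝ] ℝ)) := fun u v h ↦
    hG.eq_of_forall_apply_eq hy fun w ↦ DFunLike.congr_fun h w
  have hrank : Module.finrank ℝ E = Module.finrank ℝ (E →L[ℝ] ℝ) :=
    Subspace.dual_finrank_eq.symm.trans LinearMap.toContinuousLinearMap.finrank_eq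
  exact ⟨(LinearEquiv.ofInjectiveOfFinrankEq _ hinj hrank).toContinuousLinearEquiv, rfl⟩

lemma apply_sharp (hG : IsMetricOn G U) (hy : y ∈ U) (α : E →L[ℝ] ℝ) :
    G y (sharp G y α) = α :=
  (hG.isInvertible hy).self_apply_inverse α

lemma sharp_apply (hG : IsMetricOn G U) (hy : y ∈ U) (u : E) : sharp G y (G y u) = u :=
  (hG.isInvertible hy).inverse_apply_self u

lemma apply_apply_sharp (hG : IsMetricOn G U) (hy : y ∈ U) (u : E) (α : E →L[ℝ] ℝ) :
    G y u (sharp G y α) = α u := by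
  rw [hG.symm y hy, hG.apply_sharp hy]

lemma contDiffOn_sharp (hG : IsMetricOn G U) : ContDiffOn ℝ ∞ (sharp G) U := fun _ hy ↦
  have := FiniteDimensional.complete ℝ E
  ((hG.isInvertible hy).contDiffAt_map_inverse.comp _ (hG.contDiffAt hy)).contDiffWithinAt

lemma contDiffOn_koszul (hG : IsMetricOn G U) (u v : E) :
    ContDiffOn ℝ ∞ (fun z ↦ koszul G z u v) U := by
  have hD := hG.contDiffOn.fderiv_of_isOpen (m := ∞) hG.isOpen (by simp)
  simp only [contDiffOn_clm_apply, koszul_apply]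
  fun_prop

lemma contDiffOn_christoffelForm (hG : IsMetricOn G U) :
    ContDiffOn ℝ ∞ (christoffelForm G) U := by
  simp only [contDiffOn_clm_apply]
  exact fun u v ↦ hG.contDiffOn_sharp.clm_apply (hG.contDiffOn_koszul u v)

lemma differentiableAt_christoffelForm (hG : IsMetricOn G U) (hy : y ∈ U) :
    DifferentiableAt ℝ (christoffelForm G) y :=
  (hG.contDiffOn_christoffelForm.contDiffAt (hG.isOpen.mem_nhds hy)).differentiableAt (by simp)

lemma contDiffOn_curvatureForm (hG : IsMetricOn G U) :
    ContDiffOn ℝ ∞ (curvatureForm G) U := by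
  have hΓ := hG.contDiffOn_christoffelForm
  have hΓ' := hΓ.fderiv_of_isOpen (m := ∞) hG.isOpen (by simp)
  simp only [contDiffOn_clm_apply, curvatureForm_apply]
  fun_prop

lemma apply_christoffelForm (hG : IsMetricOn G U) (hy : y ∈ U) (u v w : E) :
    G y (christoffelForm G y u v) w =
      (fderiv ℝ G y u v w + fderiv ℝ G y v u w - fderiv ℝ G y w u v) / 2 := by
  rw [christoffelForm_apply, christoffel, hG.apply_sharp hy, koszul_apply]

lemma christoffelForm_comm (hG : IsMetricOn G U) (hy : y ∈ U) (u v : E) :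
    christoffelForm G y u v = christoffelForm G y v u := by
  refine hG.eq_of_forall_apply_eq hy fun w ↦ ?_
  rw [hG.apply_christoffelForm hy, hG.apply_christoffelForm hy, hG.fderiv_symm hy w u v]
  ring

lemma fderiv_apply (hG : IsMetricOn G U) (hy : y ∈ U) (u v w : E) :
    fderiv ℝ G y u v w =
      G y (christoffelForm G y u v) w + G y v (christoffelForm G y u w) := by
  rw [hG.symm y hy v, hG.apply_christoffelForm hy, hG.apply_christoffelForm hy,
    hG.fderiv_symm hy w u v, hG.fderiv_symm hy u w v]
  ring

lemma eq_christoffelForm (hG : IsMetricOn G U) (hy : y ∈ U) {A : E → E → E}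
    (torsion_free : ∀ u v, A u v = A v u)
    (metric : ∀ u v w, fderiv ℝ G y u v w = G y (A u v) w + G y v (A u w)) (u v : E) :
    A u v = christoffelForm G y u v := by
  refine hG.eq_of_forall_apply_eq hy fun w ↦ ?_
  rw [hG.apply_christoffelForm hy, metric, metric, metric, torsion_free w u, torsion_free w v,
    torsion_free v u, hG.symm y hy v, hG.symm y hy u (A v w)]
  ring

end IsMetricOn

end LocalMetric

/-! ### Traces, the Laplace-Beltrami operator and the Ricci tensor -/

namespace LocalMetric

variable {E F : Type*} [NormedAddCommGroup E] [NormedSpace ℝ E]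
  [NormedAddCommGroup F] [NormedSpace ℝ F]

/-- The Hessian `∇ df` as a bilinear map, for functions with values in any normed space. -/
def hessianForm (G : E → E →L[ℝ] E →L[ℝ] ℝ) (f : E → F) (y : E) : E →L[ℝ] E →L[ℝ] F :=
  fderiv ℝ (fderiv ℝ f) y -
    (ContinuousLinearMap.compL ℝ E E F (fderiv ℝ f y)).comp (christoffelForm G y)

variable {G : E → E →L[ℝ] E →L[ℝ] ℝ} {U : Set E} {y : E}

lemma hessianForm_apply (f : E → F) (u v : E) :
    hessianForm G f y u v =
      fderiv ℝ (fderiv ℝ f) y u v - fderiv ℝ f y (christoffelForm G y u v) := rfl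

variable [FiniteDimensional ℝ E]

lemma IsMetricOn.contDiffOn_hessianForm (hG : IsMetricOn G U) {f : E → F}
    (hf : ContDiffOn ℝ ∞ f U) : ContDiffOn ℝ ∞ (hessianForm G f) U := by
  have hΓ := hG.contDiffOn_christoffelForm
  have hf' := hf.fderiv_of_isOpen (m := ∞) hG.isOpen (by simp)
  have hf'' := hf'.fderiv_of_isOpen (m := ∞) hG.isOpen (by simp)
  simp only [contDiffOn_clm_apply, hessianForm_apply]
  fun_prop

section Trace

/-- The trace `∑ i, B(b_i, b^i)` of a bilinear map with respect to `G y`, where `b^i` is the basis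
dual to `b`. -/
def metricTrace (G : E → E →L[ℝ] E →L[ℝ] ℝ) (y : E) : (E →L[ℝ] E →L[ℝ] F) →L[ℝ] F :=
  ∑ i, (ContinuousLinearMap.apply ℝ F (sharp G y (coord i))).comp
    (ContinuousLinearMap.apply ℝ (E →L[ℝ] F) (Module.finBasis ℝ E i))

lemma metricTrace_apply (B : E →L[ℝ] E →L[ℝ] F) :
    metricTrace G y B = ∑ i, B (Module.finBasis ℝ E i) (sharp G y (coord i)) := by
  simp [metricTrace]

lemma sum_coord_smul (u : E) : ∑ i, (coord i u : ℝ) • Module.finBasis ℝ E i = u :=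
  (Module.finBasis ℝ E).sum_repr u

lemma metricTrace_clm_comp {F' : Type*} [NormedAddCommGroup F'] [NormedSpace ℝ F']
    (L : F →L[ℝ] F') (B : E →L[ℝ] E →L[ℝ] F) :
    metricTrace G y ((ContinuousLinearMap.compL ℝ E F F' L).comp B) = L (metricTrace G y B) := by
  simp [metricTrace_apply]

namespace IsMetricOn

lemma apply_sharp_comm (hG : IsMetricOn G U) (hy : y ∈ U) (α β : E →L[ℝ] ℝ) :
    α (sharp G y β) = β (sharp G y α) := by
  rw [← hG.apply_apply_sharp hy, hG.symm y hy, hG.apply_apply_sharp hy]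

lemma sum_apply_sharp_smul (hG : IsMetricOn G U) (hy : y ∈ U) (α : E →L[ℝ] ℝ) :
    ∑ i, α (sharp G y (coord i)) • Module.finBasis ℝ E i = sharp G y α := by
  simp only [hG.apply_sharp_comm hy α, sum_coord_smul]

lemma metricTrace_eq_sum (hG : IsMetricOn G U) (hy : y ∈ U) {ι : Type*} [Fintype ι] {b b' : ι → E}
    (dual : ∀ u, ∑ i, G y u (b' i) • b i = u) (B : E →L[ℝ] E →L[ℝ] F) :
    metricTrace G y B = ∑ i, B (b i) (b' i) := by
  have expand : ∀ j, sharp G y (coord j) = ∑ i, (coord j (b i) : ℝ) • b' i := fun j ↦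
    hG.eq_of_forall_apply_eq hy fun w ↦ by
      conv_lhs => rw [hG.apply_sharp hy, ← dual w]
      simp [hG.symm y hy w, mul_comm]
  calc metricTrace G y B
      = ∑ j, ∑ i, (coord j (b i) : ℝ) • B (Module.finBasis ℝ E j) (b' i) := by
        simp [metricTrace_apply, expand]
    _ = ∑ i, B (∑ j, (coord j (b i) : ℝ) • Module.finBasis ℝ E j) (b' i) := by
        rw [Finset.sum_comm]
        simp
    _ = ∑ i, B (b i) (b' i) := by simp only [sum_coord_smul]

lemma metricTrace_self (hG : IsMetricOn G U) (hy : y ∈ U) :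
    metricTrace G y (G y) = Module.finrank ℝ E := by
  simp [metricTrace_apply, hG.apply_apply_sharp hy, coord]

lemma metricTrace_flip (hG : IsMetricOn G U) (hy : y ∈ U) (B : E →L[ℝ] E →L[ℝ] F) :
    metricTrace G y B.flip = metricTrace G y B := by
  have dual (u : E) : ∑ i, G y u (Module.finBasis ℝ E i) • sharp G y (coord i) = u :=
    hG.eq_of_forall_apply_eq hy fun w ↦ by
      conv_rhs => rw [← sum_coord_smul w]
      simp [hG.apply_sharp hy, mul_comm]
  rw [hG.metricTrace_eq_sum hy dual, metricTrace_apply]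
  rfl

lemma metricTrace_smulRight (hG : IsMetricOn G U) (hy : y ∈ U) (α : E →L[ℝ] ℝ)
    (β : E →L[ℝ] F) :
    metricTrace G y (α.smulRight β) = β (sharp G y α) := by
  rw [← hG.metricTrace_flip hy, metricTrace_apply, ← hG.sum_apply_sharp_smul hy]
  simp

lemma contDiffOn_metricTrace (hG : IsMetricOn G U) {B : E → E →L[ℝ] E →L[ℝ] F}
    (hB : ContDiffOn ℝ ∞ B U) : ContDiffOn ℝ ∞ (fun z ↦ metricTrace G z (B z)) U := by
  simp only [metricTrace_apply]
  exact ContDiffOn.sum fun i _ ↦ (hB.clm_apply contDiffOn_const).clm_apply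
    (hG.contDiffOn_sharp.clm_apply contDiffOn_const)

end IsMetricOn

end Trace

/-- The Laplace-Beltrami operator on functions with values in any normed space. -/
def laplaceBeltrami (G : E → E →L[ℝ] E →L[ℝ] ℝ) (f : E → F) (y : E) : F :=
  metricTrace G y (hessianForm G f y)

/-- The Ricci tensor, with the sign for which it is positive on spheres. -/
def ricci (G : E → E →L[ℝ] E →L[ℝ] ℝ) (y : E) : E →L[ℝ] E →L[ℝ] ℝ :=
  (G y).comp ((metricTrace G y).comp (curvatureForm G y))

lemma laplacian_eq_laplaceBeltrami : laplacian G = laplaceBeltrami (F := ℂ) G := by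
  ext f y
  rw [laplaceBeltrami, metricTrace_apply]
  rfl

namespace IsMetricOn

lemma scalarCurvature_eq (hG : IsMetricOn G U) (hy : y ∈ U) :
    scalarCurvature G y = metricTrace G y (ricci G y) := by
  simp [scalarCurvature, curvature_const (hG.differentiableAt_christoffelForm hy),
    metricTrace_apply, ricci]

lemma contDiffOn_scalarCurvature (hG : IsMetricOn G U) :
    ContDiffOn ℝ ∞ (scalarCurvature G) U := by
  have hricci : ContDiffOn ℝ ∞ (ricci G) U := by
    have hR := contDiffOn_clm_apply.1 hG.contDiffOn_curvatureForm
    simp only [contDiffOn_clm_apply]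
    intro u v
    exact (hG.contDiffOn.clm_apply (hG.contDiffOn_metricTrace (hR u))).clm_apply contDiffOn_const
  exact (hG.contDiffOn_metricTrace hricci).congr fun y hy ↦ hG.scalarCurvature_eq hy

lemma contDiffOn_laplaceBeltrami (hG : IsMetricOn G U) {f : E → F} (hf : ContDiffOn ℝ ∞ f U) :
    ContDiffOn ℝ ∞ (laplaceBeltrami G f) U :=
  hG.contDiffOn_metricTrace (hG.contDiffOn_hessianForm hf)

end IsMetricOn

end LocalMetric

/-! ### Isometries -/

namespace LocalMetric

variable {E F : Type*} [NormedAddCommGroup E] [NormedSpace ℝ E]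
  [NormedAddCommGroup F] [NormedSpace ℝ F]

/-- `φ` maps `U` to `V`, and `φ^* G' = G` on `U`. -/
structure IsIsometryOn (G : E → E →L[ℝ] E →L[ℝ] ℝ) (U : Set E) (G' : E → E →L[ℝ] E →L[ℝ] ℝ)
    (V : Set E) (φ : E → E) : Prop where
  source : IsMetricOn G U
  target : IsMetricOn G' V
  contDiffOn : ContDiffOn ℝ ∞ φ U
  mapsTo : Set.MapsTo φ U V
  apply_eq : ∀ y ∈ U, ∀ u v, G y u v = G' (φ y) (fderiv ℝ φ y u) (fderiv ℝ φ y v)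

namespace IsIsometryOn

variable {G : E → E →L[ℝ] E →L[ℝ] ℝ} {U : Set E} {G' : E → E →L[ℝ] E →L[ℝ] ℝ} {V : Set E}
  {φ : E → E} {y : E}

lemma contDiffAt (h : IsIsometryOn G U G' V φ) (hy : y ∈ U) : ContDiffAt ℝ ∞ φ y :=
  h.contDiffOn.contDiffAt (h.source.isOpen.mem_nhds hy)

lemma hasFDerivAt (h : IsIsometryOn G U G' V φ) (hy : y ∈ U) :
    HasFDerivAt φ (fderiv ℝ φ y) y :=
  ((h.contDiffAt hy).differentiableAt (by simp)).hasFDerivAt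

lemma contDiffAt_fderiv (h : IsIsometryOn G U G' V φ) (hy : y ∈ U) :
    ContDiffAt ℝ ∞ (fderiv ℝ φ) y :=
  (h.contDiffAt hy).fderiv_right (by simp)

lemma hasFDerivAt_fderiv (h : IsIsometryOn G U G' V φ) (hy : y ∈ U) :
    HasFDerivAt (fderiv ℝ φ) (fderiv ℝ (fderiv ℝ φ) y) y :=
  ((h.contDiffAt_fderiv hy).differentiableAt (by simp)).hasFDerivAt

lemma fderiv_metric (h : IsIsometryOn G U G' V φ) (hy : y ∈ U) (u v w : E) :
    fderiv ℝ G y u v w =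
      fderiv ℝ G' (φ y) (fderiv ℝ φ y u) (fderiv ℝ φ y v) (fderiv ℝ φ y w)
      + G' (φ y) (fderiv ℝ (fderiv ℝ φ) y u v) (fderiv ℝ φ y w)
      + G' (φ y) (fderiv ℝ φ y v) (fderiv ℝ (fderiv ℝ φ) y u w) := by
  have pullback : (fun z ↦ G z v w) =ᶠ[nhds y]
      fun z ↦ G' (φ z) (fderiv ℝ φ z v) (fderiv ℝ φ z w) := by
    filter_upwards [h.source.isOpen.mem_nhds hy] with z hz using h.apply_eq z hz v w
  have hφ' := h.hasFDerivAt_fderiv hy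
  have hG' := (h.target.differentiableAt (h.mapsTo hy)).hasFDerivAt
  have deriv := ((hG'.comp y (h.hasFDerivAt hy)).clm_apply (hφ'.clm_apply
    (hasFDerivAt_const v y))).clm_apply (hφ'.clm_apply (hasFDerivAt_const w y))
  rw [fderiv_apply_apply (h.source.differentiableAt hy), pullback.fderiv_eq]
  refine (DFunLike.congr_fun deriv.fderiv u).trans ?_
  simp only [Function.comp_apply, ContinuousLinearMap.comp_zero, zero_add,
    ContinuousLinearMap.flip_add, add_apply, ContinuousLinearMap.comp_apply,
    ContinuousLinearMap.flip_apply]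
  ring

variable [FiniteDimensional ℝ E]

lemma surjective_fderiv (h : IsIsometryOn G U G' V φ) (hy : y ∈ U) :
    Function.Surjective (fderiv ℝ φ y) := by
  refine LinearMap.surjective_of_injective (f := (fderiv ℝ φ y : E →ₗ[ℝ] E)) fun u v huv ↦ ?_
  refine h.source.eq_of_forall_apply_eq hy fun w ↦ ?_
  rw [h.apply_eq y hy, h.apply_eq y hy]
  exact congrArg (fun u ↦ G' (φ y) u (fderiv ℝ φ y w)) huv

lemma map_christoffelForm (h : IsIsometryOn G U G' V φ) (hy : y ∈ U) (u v : E) :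
    fderiv ℝ φ y (christoffelForm G y u v) = fderiv ℝ (fderiv ℝ φ) y u v +
      christoffelForm G' (φ y) (fderiv ℝ φ y u) (fderiv ℝ φ y v) := by
  have hV := h.mapsTo hy
  choose A hA using fun u v ↦ h.surjective_fderiv hy (fderiv ℝ (fderiv ℝ φ) y u v +
    christoffelForm G' (φ y) (fderiv ℝ φ y u) (fderiv ℝ φ y v))
  have torsion_free (u v : E) : A u v = A v u := by
    refine h.source.eq_of_forall_apply_eq hy fun w ↦ ?_
    rw [h.apply_eq y hy, h.apply_eq y hy, hA, hA,
      fderiv_fderiv_comm ((h.contDiffAt hy).of_le ENat.LEInfty.out),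
      h.target.christoffelForm_comm hV]
  have metric (u v w : E) : fderiv ℝ G y u v w = G y (A u v) w + G y v (A u w) := by
    rw [h.fderiv_metric hy, h.apply_eq y hy, h.apply_eq y hy, hA, hA, h.target.fderiv_apply hV]
    simp only [map_add, add_apply]
    ring
  rw [← h.source.eq_christoffelForm hy torsion_free metric, hA]

lemma map_fderiv_christoffelForm (h : IsIsometryOn G U G' V φ) (hy : y ∈ U) (u v w : E) :
    fderiv ℝ (fderiv ℝ φ) y u (christoffelForm G y v w)
      + fderiv ℝ φ y (fderiv ℝ (christoffelForm G) y u v w) =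
    fderiv ℝ (fderiv ℝ (fderiv ℝ φ)) y u v w
      + fderiv ℝ (christoffelForm G') (φ y) (fderiv ℝ φ y u) (fderiv ℝ φ y v) (fderiv ℝ φ y w)
      + christoffelForm G' (φ y) (fderiv ℝ (fderiv ℝ φ) y u v) (fderiv ℝ φ y w)
      + christoffelForm G' (φ y) (fderiv ℝ φ y v) (fderiv ℝ (fderiv ℝ φ) y u w) := by
  have hφ' := h.hasFDerivAt_fderiv hy
  have hφ'' := (differentiableAt_fderiv
    ((h.contDiffAt_fderiv hy).of_le ENat.LEInfty.out)).hasFDerivAt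
  have hΓ := (h.source.differentiableAt_christoffelForm hy).hasFDerivAt
  have hΓ' := (h.target.differentiableAt_christoffelForm (h.mapsTo hy)).hasFDerivAt
  have hv := hasFDerivAt_const (𝕜 := ℝ) v y
  have hw := hasFDerivAt_const (𝕜 := ℝ) w y
  have transformation : (fun z ↦ fderiv ℝ φ z (christoffelForm G z v w)) =ᶠ[nhds y]
      fun z ↦ fderiv ℝ (fderiv ℝ φ) z v w +
        christoffelForm G' (φ z) (fderiv ℝ φ z v) (fderiv ℝ φ z w) := by
    filter_upwards [h.source.isOpen.mem_nhds hy] with z hz using h.map_christoffelForm hz v w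
  have hleft := hφ'.clm_apply ((hΓ.clm_apply hv).clm_apply hw)
  have hright := ((hφ''.clm_apply hv).clm_apply hw).add
    (((hΓ'.comp y (h.hasFDerivAt hy)).clm_apply (hφ'.clm_apply hv)).clm_apply (hφ'.clm_apply hw))
  have derivs_eq := DFunLike.congr_fun
    (hleft.unique (hright.congr_of_eventuallyEq transformation)) u
  simp only [ContinuousLinearMap.comp_zero, zero_add, add_apply,
    ContinuousLinearMap.comp_apply, ContinuousLinearMap.flip_apply, Function.comp_apply]
    at derivs_eq
  rw [add_comm, derivs_eq]
  abel

lemma map_curvatureForm (h : IsIsometryOn G U G' V φ) (hy : y ∈ U) (u v w : E) :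
    fderiv ℝ φ y (curvatureForm G y u v w) =
      curvatureForm G' (φ y) (fderiv ℝ φ y u) (fderiv ℝ φ y v) (fderiv ℝ φ y w) := by
  have huv := eq_sub_of_add_eq' (h.map_fderiv_christoffelForm hy u v w)
  have hvu := eq_sub_of_add_eq' (h.map_fderiv_christoffelForm hy v u w)
  rw [curvatureForm_apply, map_sub, map_add, map_sub, huv, hvu,
    fderiv_fderiv_comm ((h.contDiffAt_fderiv hy).of_le ENat.LEInfty.out) u v,
    fderiv_fderiv_comm ((h.contDiffAt hy).of_le ENat.LEInfty.out) u v]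
  simp only [h.map_christoffelForm hy, curvatureForm_apply, map_add]
  abel

lemma hessianForm_comp (h : IsIsometryOn G U G' V φ) (hy : y ∈ U) {f : E → F}
    (hf : ContDiffAt ℝ 2 f (φ y)) :
    hessianForm G (f ∘ φ) y =
      (hessianForm G' f (φ y)).bilinearComp (fderiv ℝ φ y) (fderiv ℝ φ y) := by
  have hφ := h.hasFDerivAt hy
  have chain : fderiv ℝ (f ∘ φ) =ᶠ[nhds y] fun z ↦ (fderiv ℝ f (φ z)).comp (fderiv ℝ φ z) := by
    filter_upwards [h.source.isOpen.mem_nhds hy,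
      hφ.continuousAt.eventually (eventually_differentiableAt hf)] with z hz hfz
    exact fderiv_comp z hfz (h.hasFDerivAt hz).differentiableAt
  have snd := (((differentiableAt_fderiv hf).hasFDerivAt.comp y hφ).clm_comp
    (h.hasFDerivAt_fderiv hy)).congr_of_eventuallyEq chain
  ext u v
  rw [hessianForm_apply, snd.fderiv, chain.eq_of_nhds, ContinuousLinearMap.bilinearComp_apply,
    hessianForm_apply]
  simp [h.map_christoffelForm hy]

lemma metricTrace_bilinearComp (h : IsIsometryOn G U G' V φ) (hy : y ∈ U)
    (B : E →L[ℝ] E →L[ℝ] F) :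
    metricTrace G y (B.bilinearComp (fderiv ℝ φ y) (fderiv ℝ φ y)) = metricTrace G' (φ y) B := by
  have dual (u : E) : ∑ i, G' (φ y) u (fderiv ℝ φ y (sharp G y (coord i))) •
      fderiv ℝ φ y (Module.finBasis ℝ E i) = u := by
    obtain ⟨u, rfl⟩ := h.surjective_fderiv hy u
    simp only [← h.apply_eq y hy, h.source.apply_apply_sharp hy, ← map_smul, ← map_sum,
      sum_coord_smul]
  rw [h.target.metricTrace_eq_sum (h.mapsTo hy) dual, metricTrace_apply]
  rfl

lemma laplaceBeltrami_comp (h : IsIsometryOn G U G' V φ) (hy : y ∈ U) {f : E → F}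
    (hf : ContDiffAt ℝ 2 f (φ y)) :
    laplaceBeltrami G (f ∘ φ) y = laplaceBeltrami G' f (φ y) := by
  rw [laplaceBeltrami, h.hessianForm_comp hy hf, h.metricTrace_bilinearComp hy, laplaceBeltrami]

lemma ricci_eq (h : IsIsometryOn G U G' V φ) (hy : y ∈ U) :
    ricci G y = (ricci G' (φ y)).bilinearComp (fderiv ℝ φ y) (fderiv ℝ φ y) := by
  ext u w
  have map_trace : fderiv ℝ φ y (metricTrace G y (curvatureForm G y u)) =
      metricTrace G' (φ y) (curvatureForm G' (φ y) (fderiv ℝ φ y u)) := by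
    rw [← metricTrace_clm_comp, ← h.metricTrace_bilinearComp hy]
    congr 1
    ext v w
    exact h.map_curvatureForm hy u v w
  simp only [ricci, ContinuousLinearMap.comp_apply, ContinuousLinearMap.bilinearComp_apply,
    ← map_trace, ← h.apply_eq y hy]

lemma scalarCurvature_eq (h : IsIsometryOn G U G' V φ) (hy : y ∈ U) :
    scalarCurvature G y = scalarCurvature G' (φ y) := by
  rw [h.source.scalarCurvature_eq hy, h.ricci_eq hy, h.metricTrace_bilinearComp hy,
    h.target.scalarCurvature_eq (h.mapsTo hy)]

end IsIsometryOn

end LocalMetric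

/-! ### Conformal change of the metric -/

namespace LocalMetric

variable {E : Type*} [NormedAddCommGroup E] [NormedSpace ℝ E]

/-- The conformal change `e ^ (2 σ) G` of the metric `G`. -/
def conformal (σ : E → ℝ) (G : E → E →L[ℝ] E →L[ℝ] ℝ) (y : E) : E →L[ℝ] E →L[ℝ] ℝ :=
  Real.exp (2 * σ y) • G y

/-- The gradient of `σ` with respect to `G`. -/
def gradient (G : E → E →L[ℝ] E →L[ℝ] ℝ) (σ : E → ℝ) (y : E) : E :=
  sharp G y (fderiv ℝ σ y)

/-- The tensor `A = ∇dσ - dσ ⊗ dσ + |dσ|² G / 2`: under the conformal change `e ^ (2 σ) G`, the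
Schouten tensor of `G` decreases by `A`. -/
def schoutenVariation (G : E → E →L[ℝ] E →L[ℝ] ℝ) (σ : E → ℝ) (y : E) : E →L[ℝ] E →L[ℝ] ℝ :=
  hessianForm G σ y - (fderiv ℝ σ y).smulRight (fderiv ℝ σ y)
    + (fderiv ℝ σ y (gradient G σ y) / 2) • G y

variable {G : E → E →L[ℝ] E →L[ℝ] ℝ} {U : Set E} {σ : E → ℝ} {y : E}

lemma conformal_zero : conformal (fun _ ↦ 0) G = G := by
  ext y
  simp [conformal]

lemma schoutenVariation_apply (u v : E) :
    schoutenVariation G σ y u v =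
      hessianForm G σ y u v - fderiv ℝ σ y u * fderiv ℝ σ y v
        + fderiv ℝ σ y (gradient G σ y) / 2 * G y u v := by
  simp [schoutenVariation]

namespace IsMetricOn

lemma conformal (hG : IsMetricOn G U) (hσ : ContDiffOn ℝ ∞ σ U) :
    IsMetricOn (conformal σ G) U where
  isOpen := hG.isOpen
  contDiffOn := (contDiffOn_const.mul hσ).exp.smul hG.contDiffOn
  symm y hy u v := by simp [LocalMetric.conformal, hG.symm y hy u v]
  nondegenerate y hy u hu := hG.nondegenerate y hy u fun v ↦ by
    simpa [LocalMetric.conformal] using hu v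

lemma contDiffAt_two_of_contDiffOn (hG : IsMetricOn G U) (hσ : ContDiffOn ℝ ∞ σ U) (hy : y ∈ U) :
    ContDiffAt ℝ 2 σ y :=
  (hσ.contDiffAt (hG.isOpen.mem_nhds hy)).of_le ENat.LEInfty.out

lemma fderiv_conformal (hG : IsMetricOn G U) (hσ : ContDiffOn ℝ ∞ σ U) (hy : y ∈ U) (u v w : E) :
    fderiv ℝ (LocalMetric.conformal σ G) y u v w =
      Real.exp (2 * σ y) * (2 * fderiv ℝ σ y u * G y v w + fderiv ℝ G y u v w) := by
  have hσ' := (hG.contDiffAt_two_of_contDiffOn hσ hy).differentiableAt (by simp)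
  have deriv := ((hσ'.hasFDerivAt.const_mul 2).exp).smul (hG.differentiableAt hy).hasFDerivAt
  refine (congrArg (fun A : E →L[ℝ] E →L[ℝ] E →L[ℝ] ℝ ↦ A u v w) deriv.fderiv).trans ?_
  simp only [add_apply, smul_apply, ContinuousLinearMap.smulRight_apply, smul_eq_mul]
  ring

variable [FiniteDimensional ℝ E]

lemma christoffelForm_conformal (hG : IsMetricOn G U) (hσ : ContDiffOn ℝ ∞ σ U) (hy : y ∈ U)
    (u v : E) :
    christoffelForm (LocalMetric.conformal σ G) y u v = christoffelForm G y u v +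
      fderiv ℝ σ y u • v + fderiv ℝ σ y v • u - G y u v • gradient G σ y := by
  refine ((hG.conformal hσ).eq_christoffelForm hy (A := fun u v ↦ christoffelForm G y u v +
    fderiv ℝ σ y u • v + fderiv ℝ σ y v • u - G y u v • gradient G σ y)
    (fun u v ↦ ?torsion_free) (fun u v w ↦ ?metric) u v).symm
  case torsion_free =>
    rw [hG.christoffelForm_comm hy u v, hG.symm y hy u v]
    abel
  case metric =>
    rw [hG.fderiv_conformal hσ hy, hG.fderiv_apply hy]
    simp only [LocalMetric.conformal, gradient, smul_apply, map_add, map_sub, map_smul, add_apply,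
      sub_apply, smul_eq_mul, hG.apply_sharp hy, hG.apply_apply_sharp hy]
    rw [hG.symm y hy v u]
    ring

lemma sharp_conformal (hG : IsMetricOn G U) (hσ : ContDiffOn ℝ ∞ σ U) (hy : y ∈ U)
    (α : E →L[ℝ] ℝ) :
    sharp (LocalMetric.conformal σ G) y α = Real.exp (-(2 * σ y)) • sharp G y α := by
  refine (hG.conformal hσ).eq_of_forall_apply_eq hy fun w ↦ ?_
  rw [(hG.conformal hσ).apply_sharp hy]
  simp [LocalMetric.conformal, hG.apply_sharp hy, ← mul_assoc, ← Real.exp_add]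

lemma differentiableAt_gradient (hG : IsMetricOn G U) (hσ : ContDiffOn ℝ ∞ σ U) (hy : y ∈ U) :
    DifferentiableAt ℝ (gradient G σ) y :=
  ((hG.contDiffOn_sharp.contDiffAt (hG.isOpen.mem_nhds hy)).differentiableAt (by simp)).clm_apply
    (differentiableAt_fderiv (hG.contDiffAt_two_of_contDiffOn hσ hy))

lemma sharp_hessianForm (hG : IsMetricOn G U) (hσ : ContDiffOn ℝ ∞ σ U) (hy : y ∈ U) (u : E) :
    sharp G y (hessianForm G σ y u) =
      fderiv ℝ (gradient G σ) y u + christoffelForm G y u (gradient G σ y) := by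
  refine hG.eq_of_forall_apply_eq hy fun v ↦ ?_
  have grad_flat : (fun z ↦ G z (gradient G σ z) v) =ᶠ[nhds y] fun z ↦ fderiv ℝ σ z v := by
    filter_upwards [hG.isOpen.mem_nhds hy] with z hz
    rw [gradient, hG.apply_sharp hz]
  have hleft := ((hG.differentiableAt hy).hasFDerivAt.clm_apply
    (hG.differentiableAt_gradient hσ hy).hasFDerivAt).clm_apply (hasFDerivAt_const v y)
  have hright := (differentiableAt_fderiv
    (hG.contDiffAt_two_of_contDiffOn hσ hy)).hasFDerivAt.clm_apply (hasFDerivAt_const v y)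
  have derivs_eq := DFunLike.congr_fun
    (hleft.unique (hright.congr_of_eventuallyEq grad_flat)) u
  simp only [ContinuousLinearMap.comp_zero, zero_add, add_apply,
    ContinuousLinearMap.comp_apply, ContinuousLinearMap.flip_apply] at derivs_eq
  have flat_grad : G y (gradient G σ y) = fderiv ℝ σ y := hG.apply_sharp hy _
  rw [hG.fderiv_apply hy, flat_grad] at derivs_eq
  rw [hG.apply_sharp hy, hessianForm_apply, ← derivs_eq]
  simp only [map_add, add_apply]
  ring

lemma sharp_schoutenVariation (hG : IsMetricOn G U) (hσ : ContDiffOn ℝ ∞ σ U) (hy : y ∈ U)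
    (u : E) :
    sharp G y (schoutenVariation G σ y u) =
      fderiv ℝ (gradient G σ) y u + christoffelForm G y u (gradient G σ y)
        - fderiv ℝ σ y u • gradient G σ y + (fderiv ℝ σ y (gradient G σ y) / 2) • u := by
  simp [schoutenVariation, hG.sharp_hessianForm hσ hy, hG.sharp_apply hy, gradient]

lemma fderiv_christoffelForm_conformal (hG : IsMetricOn G U) (hσ : ContDiffOn ℝ ∞ σ U)
    (hy : y ∈ U) (u v w : E) :
    fderiv ℝ (christoffelForm (LocalMetric.conformal σ G)) y u v w =
      fderiv ℝ (christoffelForm G) y u v w + fderiv ℝ (fderiv ℝ σ) y u v • w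
      + fderiv ℝ (fderiv ℝ σ) y u w • v
      - fderiv ℝ G y u v w • gradient G σ y - G y v w • fderiv ℝ (gradient G σ) y u := by
  have hσ' := (differentiableAt_fderiv (hG.contDiffAt_two_of_contDiffOn hσ hy)).hasFDerivAt
  have christoffel_eq : (fun z ↦ christoffelForm (LocalMetric.conformal σ G) z v w) =ᶠ[nhds y]
      fun z ↦ christoffelForm G z v w + fderiv ℝ σ z v • w + fderiv ℝ σ z w • v
        - G z v w • gradient G σ z := by
    filter_upwards [hG.isOpen.mem_nhds hy] with z hz using hG.christoffelForm_conformal hσ hz v w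
  have hv := hasFDerivAt_const (𝕜 := ℝ) v y
  have hw := hasFDerivAt_const (𝕜 := ℝ) w y
  have deriv := (((((hG.differentiableAt_christoffelForm hy).hasFDerivAt.clm_apply hv).clm_apply
    hw).add ((hσ'.clm_apply hv).smul hw)).add ((hσ'.clm_apply hw).smul hv)).sub
    ((((hG.differentiableAt hy).hasFDerivAt.clm_apply hv).clm_apply hw).smul
      (hG.differentiableAt_gradient hσ hy).hasFDerivAt)
  rw [fderiv_apply_apply ((hG.conformal hσ).differentiableAt_christoffelForm hy)]
  refine (DFunLike.congr_fun (deriv.congr_of_eventuallyEq christoffel_eq).fderiv u).trans ?_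
  simp only [ContinuousLinearMap.comp_zero, zero_add, smul_zero, sub_apply, add_apply,
    ContinuousLinearMap.flip_apply, ContinuousLinearMap.smulRight_apply, smul_apply]
  abel

/-- The curvature changes by the Kulkarni-Nomizu product of `G` and `schoutenVariation G σ`. -/
lemma curvatureForm_conformal (hG : IsMetricOn G U) (hσ : ContDiffOn ℝ ∞ σ U) (hy : y ∈ U)
    (u v w : E) :
    curvatureForm (LocalMetric.conformal σ G) y u v w = curvatureForm G y u v w
      + schoutenVariation G σ y u w • v - schoutenVariation G σ y v w • u
      - G y v w • sharp G y (schoutenVariation G σ y u)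
      + G y u w • sharp G y (schoutenVariation G σ y v) := by
  have apply_grad (u : E) : G y u (gradient G σ y) = fderiv ℝ σ y u := hG.apply_apply_sharp hy u _
  simp only [curvatureForm_apply, hG.fderiv_christoffelForm_conformal hσ hy,
    hG.christoffelForm_conformal hσ hy, hG.sharp_schoutenVariation hσ hy, schoutenVariation_apply,
    map_add, map_sub, map_smul, hG.fderiv_apply hy, apply_grad, hessianForm_apply, smul_eq_mul]
  rw [hG.christoffelForm_comm hy v u, hG.symm y hy v u,
    fderiv_fderiv_comm (hG.contDiffAt_two_of_contDiffOn hσ hy) v u]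
  module

variable {F : Type*} [NormedAddCommGroup F] [NormedSpace ℝ F]

lemma metricTrace_conformal (hG : IsMetricOn G U) (hσ : ContDiffOn ℝ ∞ σ U) (hy : y ∈ U)
    (B : E →L[ℝ] E →L[ℝ] F) :
    metricTrace (LocalMetric.conformal σ G) y B =
      Real.exp (-(2 * σ y)) • metricTrace G y B := by
  simp [metricTrace_apply, hG.sharp_conformal hσ hy, Finset.smul_sum]

lemma metricTrace_schoutenVariation (hG : IsMetricOn G U) (hy : y ∈ U) :
    metricTrace G y (schoutenVariation G σ y) =
      laplaceBeltrami G σ y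
        + (Module.finrank ℝ E - 2) / 2 * fderiv ℝ σ y (gradient G σ y) := by
  simp only [schoutenVariation, map_add, map_sub, map_smul, hG.metricTrace_smulRight hy,
    hG.metricTrace_self hy, laplaceBeltrami, gradient, smul_eq_mul]
  ring

lemma ricci_conformal (hG : IsMetricOn G U) (hσ : ContDiffOn ℝ ∞ σ U) (hy : y ∈ U) :
    ricci (LocalMetric.conformal σ G) y = ricci G y
      - ((Module.finrank ℝ E : ℝ) - 2) • schoutenVariation G σ y
      - metricTrace G y (schoutenVariation G σ y) • G y := by
  ext u w
  set A := schoutenVariation G σ y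
  have curvature_eq : curvatureForm (LocalMetric.conformal σ G) y u =
      curvatureForm G y u + ((A u).smulRight (ContinuousLinearMap.id ℝ E)).flip
      - (ContinuousLinearMap.compL ℝ E ℝ E (.toSpanSingleton ℝ u)).comp A
      - (ContinuousLinearMap.compL ℝ E ℝ E (.toSpanSingleton ℝ (sharp G y (A u)))).comp (G y)
      + ((G y u).smulRight ((sharp G y).comp A)).flip := by
    ext v w
    simp [hG.curvatureForm_conformal hσ hy, A]
  have trace_eq : metricTrace G y (curvatureForm (LocalMetric.conformal σ G) y u) =
      metricTrace G y (curvatureForm G y u)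
        - ((Module.finrank ℝ E : ℝ) - 2) • sharp G y (A u) - metricTrace G y A • u := by
    simp only [curvature_eq, map_add, map_sub, hG.metricTrace_flip hy, hG.metricTrace_smulRight hy,
      metricTrace_clm_comp, hG.metricTrace_self hy, hG.sharp_apply hy,
      ContinuousLinearMap.toSpanSingleton_apply, ContinuousLinearMap.comp_apply,
      ContinuousLinearMap.id_apply]
    module
  simp only [ricci, ContinuousLinearMap.comp_apply, hG.metricTrace_conformal hσ hy, trace_eq,
    LocalMetric.conformal, smul_apply, map_smul, map_sub, sub_apply, hG.apply_sharp hy,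
    smul_eq_mul]
  have exp_cancel : Real.exp (-(2 * σ y)) * Real.exp (2 * σ y) = 1 := by
    rw [← Real.exp_add, neg_add_cancel, Real.exp_zero]
  linear_combination (G y (metricTrace G y (curvatureForm G y u)) w
    - ((Module.finrank ℝ E : ℝ) - 2) * A u w - metricTrace G y A * G y u w) * exp_cancel

lemma scalarCurvature_conformal (hG : IsMetricOn G U) (hσ : ContDiffOn ℝ ∞ σ U) (hy : y ∈ U) :
    scalarCurvature (LocalMetric.conformal σ G) y = Real.exp (-(2 * σ y)) *
      (scalarCurvature G y
        - 2 * (Module.finrank ℝ E - 1) * metricTrace G y (schoutenVariation G σ y)) := by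
  rw [(hG.conformal hσ).scalarCurvature_eq hy, hG.scalarCurvature_eq hy,
    hG.metricTrace_conformal hσ hy, hG.ricci_conformal hσ hy]
  simp only [map_sub, map_smul, hG.metricTrace_self hy, smul_eq_mul]
  ring

lemma laplaceBeltrami_conformal (hG : IsMetricOn G U) (hσ : ContDiffOn ℝ ∞ σ U) (hy : y ∈ U)
    (f : E → F) :
    laplaceBeltrami (LocalMetric.conformal σ G) f y = Real.exp (-(2 * σ y)) •
      (laplaceBeltrami G f y
        + ((Module.finrank ℝ E : ℝ) - 2) • fderiv ℝ f y (gradient G σ y)) := by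
  have hessian_eq : hessianForm (LocalMetric.conformal σ G) f y = hessianForm G f y
      - (fderiv ℝ σ y).smulRight (fderiv ℝ f y)
      - ((fderiv ℝ σ y).smulRight (fderiv ℝ f y)).flip
      + (ContinuousLinearMap.compL ℝ E ℝ F
        (.toSpanSingleton ℝ (fderiv ℝ f y (gradient G σ y)))).comp (G y) := by
    ext u v
    simp only [hessianForm_apply, hG.christoffelForm_conformal hσ hy, map_sub, map_add, map_smul,
      add_apply, sub_apply, smul_apply, ContinuousLinearMap.smulRight_apply,
      ContinuousLinearMap.comp_apply, ContinuousLinearMap.compL_apply,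
      ContinuousLinearMap.flip_apply, ContinuousLinearMap.toSpanSingleton_apply]
    abel
  simp only [laplaceBeltrami, hG.metricTrace_conformal hσ hy, hessian_eq, map_add, map_sub,
    hG.metricTrace_flip hy, hG.metricTrace_smulRight hy, metricTrace_clm_comp,
    hG.metricTrace_self hy, ContinuousLinearMap.toSpanSingleton_apply, gradient]
  module

end IsMetricOn

end LocalMetric

/-! ### The Yamabe operator on an open subset of a vector space -/

namespace LocalMetric

variable {E F : Type*} [NormedAddCommGroup E] [NormedSpace ℝ E]
  [NormedAddCommGroup F] [NormedSpace ℝ F]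
  {G : E → E →L[ℝ] E →L[ℝ] ℝ} {σ : E → ℝ} {y : E}

section Hessian

lemma hessianForm_add {f₁ f₂ : E → F} (h₁ : ContDiffAt ℝ 2 f₁ y) (h₂ : ContDiffAt ℝ 2 f₂ y) :
    hessianForm G (f₁ + f₂) y = hessianForm G f₁ y + hessianForm G f₂ y := by
  have fderiv_eq : fderiv ℝ (f₁ + f₂) =ᶠ[nhds y] fderiv ℝ f₁ + fderiv ℝ f₂ := by
    filter_upwards [eventually_differentiableAt h₁, eventually_differentiableAt h₂] with z hz₁ hz₂
      using fderiv_add hz₁ hz₂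
  ext u v
  simp only [hessianForm_apply, add_apply, fderiv_eq.fderiv_eq, fderiv_eq.eq_of_nhds,
    fderiv_add (differentiableAt_fderiv h₁) (differentiableAt_fderiv h₂), Pi.add_apply]
  abel

lemma hessianForm_const_smul (c : ℂ) (f : E → ℂ) :
    hessianForm G (c • f) y = c • hessianForm G f y := by
  ext u v
  simp only [hessianForm_apply, smul_apply, fderiv_const_smul_field, Pi.smul_apply, smul_sub]

lemma hasFDerivAt_cexp_mul (hσ : DifferentiableAt ℝ σ y) {f : E → ℂ}
    (hf : DifferentiableAt ℝ f y) (a : ℂ) :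
    HasFDerivAt (fun z ↦ Complex.exp (a * σ z) * f z)
      (Complex.exp (a * σ y) • (fderiv ℝ f y + (fderiv ℝ σ y).smulRight (a * f y))) y := by
  refine ((((Complex.ofRealCLM.hasFDerivAt.comp y hσ.hasFDerivAt).const_mul a).cexp).mul
    hf.hasFDerivAt).congr_fderiv ?_
  ext u
  simp only [Function.comp_apply, Complex.ofRealCLM_apply, add_apply, smul_apply, smul_eq_mul,
    ContinuousLinearMap.comp_apply, ContinuousLinearMap.smulRight_apply, Complex.real_smul]
  ring

lemma hessianForm_cexp_mul (hσ : ContDiffAt ℝ 2 σ y) {f : E → ℂ} (hf : ContDiffAt ℝ 2 f y)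
    (a : ℂ) (u v : E) :
    hessianForm G (fun z ↦ Complex.exp (a * σ z) * f z) y u v = Complex.exp (a * σ y) *
      (hessianForm G f y u v
        + a * (fderiv ℝ σ y u * fderiv ℝ f y v + fderiv ℝ σ y v * fderiv ℝ f y u)
        + (a * hessianForm G σ y u v + a ^ 2 * fderiv ℝ σ y u * fderiv ℝ σ y v) * f y) := by
  have hσ' := hσ.differentiableAt (by simp)
  have hf' := hf.differentiableAt (by simp)
  have hσ'' := (differentiableAt_fderiv hσ).clm_apply (differentiableAt_const v)
  have hf'' := (differentiableAt_fderiv hf).clm_apply (differentiableAt_const v)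
  have product_contDiffAt : ContDiffAt ℝ 2 (fun z ↦ Complex.exp (a * σ z) * f z) y :=
    (contDiffAt_const.mul (Complex.ofRealCLM.contDiff.contDiffAt.comp y hσ)).cexp.mul hf
  have fderiv_eq : (fun z ↦ fderiv ℝ (fun z ↦ Complex.exp (a * σ z) * f z) z v) =ᶠ[nhds y] fun z ↦
      Complex.exp (a * σ z) * (fderiv ℝ f z v + fderiv ℝ σ z v • (a * f z)) := by
    filter_upwards [eventually_differentiableAt hσ, eventually_differentiableAt hf] with z hσz hfz
    rw [(hasFDerivAt_cexp_mul hσz hfz a).fderiv]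
    rfl
  have inner_differentiableAt := hf''.fun_add (hσ''.fun_smul (hf'.const_mul a))
  have fderiv_inner : fderiv ℝ (fun z ↦ fderiv ℝ f z v + fderiv ℝ σ z v • (a * f z)) y u =
      fderiv ℝ (fderiv ℝ f) y u v + fderiv ℝ σ y v • (a * fderiv ℝ f y u)
        + fderiv ℝ (fderiv ℝ σ) y u v • (a * f y) := by
    rw [fderiv_fun_add hf'' (hσ''.fun_smul (hf'.const_mul a)),
      fderiv_fun_smul hσ'' (hf'.const_mul a), fderiv_const_mul hf']
    simp [fderiv_fderiv_apply hf, fderiv_fderiv_apply hσ, add_assoc]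
  rw [hessianForm_apply, ← fderiv_fderiv_apply product_contDiffAt, fderiv_eq.fderiv_eq,
    (hasFDerivAt_cexp_mul hσ' inner_differentiableAt a).fderiv,
    (hasFDerivAt_cexp_mul hσ' hf' a).fderiv, smul_apply, add_apply, fderiv_inner]
  simp only [Complex.real_smul, ContinuousLinearMap.smulRight_apply, smul_eq_mul, smul_add,
    add_apply, smul_apply, hessianForm_apply, Complex.ofReal_sub]
  ring

end Hessian

variable [FiniteDimensional ℝ E] {U : Set E}

lemma metricTrace_const_smul (c : ℂ) (B : E →L[ℝ] E →L[ℝ] ℂ) :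
    metricTrace G y (c • B) = c • metricTrace G y B := by
  simp [metricTrace_apply, Finset.mul_sum]

namespace IsMetricOn

lemma laplaceBeltrami_cexp_mul (hG : IsMetricOn G U) (hy : y ∈ U) (hσ : ContDiffAt ℝ 2 σ y)
    {f : E → ℂ} (hf : ContDiffAt ℝ 2 f y) (a : ℂ) :
    laplaceBeltrami G (fun z ↦ Complex.exp (a * σ z) * f z) y = Complex.exp (a * σ y) *
      (laplaceBeltrami G f y + 2 * a * fderiv ℝ f y (gradient G σ y)
        + (a * laplaceBeltrami G σ y + a ^ 2 * fderiv ℝ σ y (gradient G σ y)) * f y) := by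
  have hessian_eq : hessianForm G (fun z ↦ Complex.exp (a * σ z) * f z) y =
      Complex.exp (a * σ y) • (hessianForm G f y
        + a • ((fderiv ℝ σ y).smulRight (fderiv ℝ f y)
          + ((fderiv ℝ σ y).smulRight (fderiv ℝ f y)).flip)
        + (ContinuousLinearMap.compL ℝ E ℝ ℂ (.toSpanSingleton ℝ (a * f y))).comp
          (hessianForm G σ y)
        + (fderiv ℝ σ y).smulRight ((fderiv ℝ σ y).smulRight (a ^ 2 * f y))) := by
    ext u v
    rw [hessianForm_cexp_mul hσ hf]
    simp only [smul_add, add_apply, smul_apply, ContinuousLinearMap.smulRight_apply,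
      ContinuousLinearMap.comp_apply, ContinuousLinearMap.compL_apply, smul_eq_mul,
      Complex.real_smul, ContinuousLinearMap.flip_apply, ContinuousLinearMap.toSpanSingleton_apply]
    ring
  simp only [laplaceBeltrami, gradient, hessian_eq, metricTrace_const_smul, map_add,
    hG.metricTrace_flip hy, hG.metricTrace_smulRight hy, metricTrace_clm_comp,
    ContinuousLinearMap.toSpanSingleton_apply, ContinuousLinearMap.smulRight_apply, smul_eq_mul,
    Complex.real_smul]
  ring

end IsMetricOn

/-- The Yamabe operator of a metric on an open subset of `E`. -/
def yamabe (G : E → E →L[ℝ] E →L[ℝ] ℝ) (f : E → ℂ) (y : E) : ℂ :=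
  laplaceBeltrami G f y -
    ((Module.finrank ℝ E : ℂ) - 2) / (4 * ((Module.finrank ℝ E : ℂ) - 1)) *
      (scalarCurvature G y : ℂ) * f y

lemma yamabe_add {f₁ f₂ : E → ℂ} (h₁ : ContDiffAt ℝ 2 f₁ y) (h₂ : ContDiffAt ℝ 2 f₂ y) :
    yamabe G (f₁ + f₂) y = yamabe G f₁ y + yamabe G f₂ y := by
  simp only [yamabe, laplaceBeltrami, hessianForm_add h₁ h₂, map_add, Pi.add_apply]
  ring

lemma yamabe_const_smul (c : ℂ) (f : E → ℂ) : yamabe G (c • f) y = c * yamabe G f y := by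
  simp only [yamabe, laplaceBeltrami, hessianForm_const_smul, metricTrace_const_smul,
    Pi.smul_apply, smul_eq_mul]
  ring

lemma yamabe_congr {f₁ f₂ : E → ℂ} (h : f₁ =ᶠ[nhds y] f₂) : yamabe G f₁ y = yamabe G f₂ y := by
  simp only [yamabe, laplaceBeltrami, hessianForm, h.fderiv.fderiv_eq, h.fderiv_eq, h.eq_of_nhds]

lemma IsIsometryOn.yamabe_comp {G' : E → E →L[ℝ] E →L[ℝ] ℝ} {V : Set E} {φ : E → E}
    (h : IsIsometryOn G U G' V φ) (hy : y ∈ U) {f : E → ℂ} (hf : ContDiffAt ℝ 2 f (φ y)) :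
    yamabe G (f ∘ φ) y = yamabe G' f (φ y) := by
  rw [yamabe, yamabe, h.laplaceBeltrami_comp hy hf, h.scalarCurvature_eq hy, Function.comp_apply]

namespace IsMetricOn

lemma contDiffOn_yamabe (hG : IsMetricOn G U) {f : E → ℂ} (hf : ContDiffOn ℝ ∞ f U) :
    ContDiffOn ℝ ∞ (yamabe G f) U :=
  (hG.contDiffOn_laplaceBeltrami hf).sub ((contDiffOn_const.mul
    (Complex.ofRealCLM.contDiff.comp_contDiffOn hG.contDiffOn_scalarCurvature)).mul hf)

/-- The exponent `(n - 2) / 2` makes the first-order terms in `f` of the two sides agree. -/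
lemma yamabe_cexp_mul (hn : Module.finrank ℝ E ≠ 1) (hG : IsMetricOn G U)
    (hσ : ContDiffOn ℝ ∞ σ U) (hy : y ∈ U) {f : E → ℂ} (hf : ContDiffAt ℝ 2 f y) :
    yamabe G (fun z ↦ Complex.exp (((Module.finrank ℝ E : ℂ) - 2) / 2 * σ z) * f z) y =
      Complex.exp (((Module.finrank ℝ E : ℂ) + 2) / 2 * σ y) *
        yamabe (LocalMetric.conformal σ G) f y := by
  have hn' : (Module.finrank ℝ E : ℂ) - 1 ≠ 0 := sub_ne_zero.2 (by exact_mod_cast hn)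
  have weight_eq : Complex.exp (((Module.finrank ℝ E : ℂ) + 2) / 2 * σ y) *
      Complex.exp (-(2 * σ y)) = Complex.exp (((Module.finrank ℝ E : ℂ) - 2) / 2 * σ y) := by
    rw [← Complex.exp_add]
    ring_nf
  simp only [yamabe, hG.laplaceBeltrami_cexp_mul hy (hG.contDiffAt_two_of_contDiffOn hσ hy) hf,
    hG.laplaceBeltrami_conformal hσ hy, hG.scalarCurvature_conformal hσ hy,
    hG.metricTrace_schoutenVariation hy, Complex.real_smul, ← weight_eq]
  push_cast
  field_simp
  ring

end IsMetricOn

end LocalMetric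

/-! ### Charts -/

lemma exists_apply_apply_ne_zero {V : Type*} [AddCommGroup V] [Module ℝ V] [TopologicalSpace V]
    [Nontrivial V] {B : V →L[ℝ] V →L[ℝ] ℝ} (hB : ∀ u, (∀ v, B u v = 0) → u = 0) :
    ∃ u v, B u v ≠ 0 := by
  obtain ⟨u, hu⟩ := exists_ne (0 : V)
  by_contra! h
  exact hu (hB u (h u))

lemma ofReal_cpow_eq_exp {t : ℝ} (ht : 0 < t) (a : ℂ) :
    (t : ℂ) ^ a = Complex.exp (a * (Real.log t : ℝ)) := by
  rw [Complex.cpow_def_of_ne_zero (by exact_mod_cast ht.ne'), Complex.ofReal_log ht.le, mul_comm]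

open LocalMetric IsManifold

section Charts

section Topology

variable {E E' M N : Type*} [TopologicalSpace E] [TopologicalSpace E'] [TopologicalSpace M]
  [TopologicalSpace N] {e : OpenPartialHomeomorph M E} {e' : OpenPartialHomeomorph N E'}
  {Φ : M → N} {x : M} {y : E}

/-- The map `Φ` read in the charts `e` and `e'`; only meaningful on `readInChartsDomain e e' Φ`. -/
def readInCharts (e : OpenPartialHomeomorph M E) (e' : OpenPartialHomeomorph N E') (Φ : M → N) :
    E → E' :=
  e' ∘ Φ ∘ e.symm

/-- The points of the chart `e` which `Φ` maps into the chart `e'`. -/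
def readInChartsDomain (e : OpenPartialHomeomorph M E) (e' : OpenPartialHomeomorph N E')
    (Φ : M → N) : Set E :=
  e.target ∩ (Φ ∘ e.symm) ⁻¹' e'.source

lemma mem_readInChartsDomain (hx : x ∈ e.source) (hx' : Φ x ∈ e'.source) :
    e x ∈ readInChartsDomain e e' Φ :=
  ⟨e.map_source hx, by simpa [hx] using hx'⟩

lemma isOpen_readInChartsDomain (hΦ : Continuous Φ) : IsOpen (readInChartsDomain e e' Φ) :=
  (hΦ.comp_continuousOn e.continuousOn_symm).isOpen_inter_preimage e.open_target e'.open_source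

lemma symm_readInCharts (hy : y ∈ readInChartsDomain e e' Φ) :
    e'.symm (readInCharts e e' Φ y) = Φ (e.symm y) :=
  e'.left_inv hy.2

lemma mapsTo_readInCharts :
    Set.MapsTo (readInCharts e e' Φ) (readInChartsDomain e e' Φ) e'.target :=
  fun _ hy ↦ e'.map_source hy.2

end Topology

variable {E E' F : Type*} [NormedAddCommGroup E] [NormedSpace ℝ E]
  [NormedAddCommGroup E'] [NormedSpace ℝ E'] [NormedAddCommGroup F] [NormedSpace ℝ F]
  {M N : Type*} [TopologicalSpace M] [ChartedSpace E M] [TopologicalSpace N] [ChartedSpace E' N]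
  {e : OpenPartialHomeomorph M E} {e' : OpenPartialHomeomorph N E'}
  {Φ : M → N} {x : M} {y : E}

lemma mfderiv_symm_fderiv_readInCharts (hΦ : MDifferentiable 𝓘(ℝ, E) 𝓘(ℝ, E') Φ)
    (he : e.MDifferentiable 𝓘(ℝ, E) 𝓘(ℝ, E)) (he' : e'.MDifferentiable 𝓘(ℝ, E') 𝓘(ℝ, E'))
    (hy : y ∈ readInChartsDomain e e' Φ) (w : E) :
    (mfderiv 𝓘(ℝ, E') 𝓘(ℝ, E') e'.symm (readInCharts e e' Φ y)
      (fderiv ℝ (readInCharts e e' Φ) y w) : E') =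
      mfderiv 𝓘(ℝ, E) 𝓘(ℝ, E') Φ (e.symm y) (mfderiv 𝓘(ℝ, E) 𝓘(ℝ, E) e.symm y w) := by
  have symm_mdifferentiableAt := he.mdifferentiableAt_symm hy.1
  have read_mdifferentiableAt : MDifferentiableAt 𝓘(ℝ, E) 𝓘(ℝ, E') (readInCharts e e' Φ) y :=
    (he'.mdifferentiableAt hy.2).comp y ((hΦ _).comp y symm_mdifferentiableAt)
  have symm_comp_read : e'.symm ∘ readInCharts e e' Φ =ᶠ[nhds y] Φ ∘ e.symm := by
    filter_upwards [(isOpen_readInChartsDomain hΦ.continuous).mem_nhds hy] with z hz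
      using symm_readInCharts hz
  have derivatives_eq := ((mfderiv_comp y (he'.mdifferentiableAt_symm (mapsTo_readInCharts hy))
    read_mdifferentiableAt).symm.trans symm_comp_read.mfderiv_eq).trans
      (mfderiv_comp y (hΦ _) symm_mdifferentiableAt)
  rw [← mfderiv_eq_fderiv]
  exact congrArg (fun A : E →L[ℝ] E' ↦ A w) derivatives_eq

lemma mdifferentiable_of_mem_maximalAtlas (he : e ∈ maximalAtlas 𝓘(ℝ, E) ∞ M) :
    e.MDifferentiable 𝓘(ℝ, E) 𝓘(ℝ, E) :=
  ⟨(contMDiffOn_of_mem_maximalAtlas he).mdifferentiableOn (by simp),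
    (contMDiffOn_symm_of_mem_maximalAtlas he).mdifferentiableOn (by simp)⟩

lemma contDiffOn_readInCharts (hΦ : ContMDiff 𝓘(ℝ, E) 𝓘(ℝ, E') ∞ Φ)
    (he : e ∈ maximalAtlas 𝓘(ℝ, E) ∞ M) (he' : e' ∈ maximalAtlas 𝓘(ℝ, E') ∞ N) :
    ContDiffOn ℝ ∞ (readInCharts e e' Φ) (readInChartsDomain e e' Φ) :=
  ((contMDiffOn_of_mem_maximalAtlas he').comp (t := e'.source)
    ((hΦ.comp_contMDiffOn (contMDiffOn_symm_of_mem_maximalAtlas he)).mono Set.inter_subset_left)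
    (fun _ hz ↦ hz.2)).contDiffOn

lemma contDiffOn_comp_symm {f : M → F} (hf : ContMDiff 𝓘(ℝ, E) 𝓘(ℝ, F) ∞ f)
    (he : e ∈ maximalAtlas 𝓘(ℝ, E) ∞ M) : ContDiffOn ℝ ∞ (f ∘ e.symm) e.target :=
  (hf.comp_contMDiffOn (contMDiffOn_symm_of_mem_maximalAtlas he)).contDiffOn

lemma contDiffAt_two_comp_symm {f : M → F} (hf : ContMDiff 𝓘(ℝ, E) 𝓘(ℝ, F) ∞ f)
    (he : e ∈ maximalAtlas 𝓘(ℝ, E) ∞ M) (hy : y ∈ e.target) :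
    ContDiffAt ℝ 2 (f ∘ e.symm) y :=
  ((contDiffOn_comp_symm hf he).contDiffAt (e.open_target.mem_nhds hy)).of_le ENat.LEInfty.out

lemma contMDiffAt_of_contDiffAt_comp_symm {f : M → F} (he : e ∈ maximalAtlas 𝓘(ℝ, E) ∞ M)
    (hx : x ∈ e.source) (hf : ContDiffAt ℝ ∞ (f ∘ e.symm) (e x)) :
    ContMDiffAt 𝓘(ℝ, E) 𝓘(ℝ, F) ∞ f x := by
  refine (hf.contMDiffAt.comp x ((contMDiffOn_of_mem_maximalAtlas he).contMDiffAt
    (e.open_source.mem_nhds hx))).congr_of_eventuallyEq ?_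
  filter_upwards [e.open_source.mem_nhds hx] with z hz
  simp only [Function.comp_apply, e.left_inv hz]

lemma contMDiff_ofReal_cpow {Ω : M → ℝ} (hpos : ∀ x, 0 < Ω x) (hΩ : ContMDiff 𝓘(ℝ, E) 𝓘(ℝ, ℝ) ∞ Ω)
    (a : ℂ) : ContMDiff 𝓘(ℝ, E) 𝓘(ℝ, ℂ) ∞ (fun x ↦ (Ω x : ℂ) ^ a) := by
  intro x
  have exp_log_contDiffAt : ContDiffAt ℝ ∞ (fun t : ℝ ↦ Complex.exp (a * (Real.log t : ℝ))) (Ω x) :=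
    (contDiffAt_const.mul (Complex.ofRealCLM.contDiff.contDiffAt.comp _
      (Real.contDiffAt_log.2 (hpos x).ne'))).cexp
  simpa only [Function.comp_def, ← ofReal_cpow_eq_exp (hpos _)] using
    exp_log_contDiffAt.contMDiffAt.comp x (hΩ x)

end Charts

variable {E : Type*} [NormedAddCommGroup E] [NormedSpace ℝ E]
  {M : Type*} [TopologicalSpace M] [ChartedSpace E M] [IsManifold 𝓘(ℝ, E) ∞ M]
  {g : PseudoRiemannianMetric E M} {e e' : OpenPartialHomeomorph M E}
  {Φ Ψ : M → M} {Ω Ω' : M → ℝ} {y : E}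

lemma contMDiffOn_mfderiv_symm_apply (he : e ∈ maximalAtlas 𝓘(ℝ, E) ∞ M) (w : E) :
    ContMDiffOn 𝓘(ℝ, E) 𝓘(ℝ, E).tangent ∞
      (fun y ↦ Bundle.TotalSpace.mk' E (E := TangentSpace 𝓘(ℝ, E) (M := M)) (e.symm y)
        (mfderiv 𝓘(ℝ, E) 𝓘(ℝ, E) e.symm y w)) e.target := by
  have const_section : ContMDiff 𝓘(ℝ, E) 𝓘(ℝ, E).tangent ∞
      (fun y : E ↦ (⟨y, w⟩ : TangentBundle 𝓘(ℝ, E) E)) := fun _ ↦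
    contMDiffAt_vectorSpace_iff_contDiffAt (V := fun _ ↦ w).2 contDiffAt_const
  refine (((contMDiffOn_symm_of_mem_maximalAtlas he).contMDiffOn_tangentMapWithin (m := ∞)
    (by simp) e.open_target.uniqueMDiffOn).comp const_section.contMDiffOn
      (fun _ hy ↦ hy)).congr fun y hy ↦ ?_
  simp only [Function.comp_apply, tangentMapWithin, mfderivWithin_of_isOpen e.open_target hy]

namespace PseudoRiemannianMetric

lemma inChart_apply (g : PseudoRiemannianMetric E M) (e : OpenPartialHomeomorph M E) (y u v : E) :
    g.inChart e y u v = g.val (e.symm y) (mfderiv 𝓘(ℝ, E) 𝓘(ℝ, E) e.symm y u)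
      (mfderiv 𝓘(ℝ, E) 𝓘(ℝ, E) e.symm y v) := rfl

lemma contDiffOn_inChart_apply (g : PseudoRiemannianMetric E M)
    (he : e ∈ maximalAtlas 𝓘(ℝ, E) ∞ M) (u v : E) :
    ContDiffOn ℝ ∞ (fun y ↦ g.inChart e y u v) e.target := by
  have total_section := ContMDiffOn.clm_bundle_apply₂ (F₁ := E) (F₂ := E) (F₃ := ℝ)
    (E₁ := fun x : M ↦ TangentSpace 𝓘(ℝ, E) x) (E₂ := fun x : M ↦ TangentSpace 𝓘(ℝ, E) x)
    (E₃ := Bundle.Trivial M ℝ) (b := e.symm) (ψ := fun y ↦ g.val (e.symm y))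
    (g.contMDiff.comp_contMDiffOn (contMDiffOn_symm_of_mem_maximalAtlas he))
    (contMDiffOn_mfderiv_symm_apply he u) (contMDiffOn_mfderiv_symm_apply he v)
  exact contMDiffOn_iff_contDiffOn.1 fun y hy ↦
    (Bundle.contMDiffWithinAt_totalSpace.1 (total_section y hy)).2

variable [FiniteDimensional ℝ E]

lemma isMetricOn_inChart (g : PseudoRiemannianMetric E M)
    (he : e ∈ maximalAtlas 𝓘(ℝ, E) ∞ M) : IsMetricOn (g.inChart e) e.target where
  isOpen := e.open_target
  contDiffOn := contDiffOn_clm_apply.2 fun u ↦ contDiffOn_clm_apply.2 fun v ↦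
    g.contDiffOn_inChart_apply he u v
  symm y _ u v := g.symm (e.symm y) (mfderiv 𝓘(ℝ, E) 𝓘(ℝ, E) e.symm y u)
    (mfderiv 𝓘(ℝ, E) 𝓘(ℝ, E) e.symm y v)
  nondegenerate y hy u hu := by
    have bijective := (mdifferentiable_of_mem_maximalAtlas he).symm.mfderiv_bijective hy
    have image_eq_zero : mfderiv 𝓘(ℝ, E) 𝓘(ℝ, E) e.symm y u = 0 :=
      g.nondegenerate (e.symm y) _ (bijective.surjective.forall.2 hu)
    exact bijective.injective (image_eq_zero.trans (map_zero _).symm)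

end PseudoRiemannianMetric

/-! ### Conformal maps and twisted representations -/

namespace IsConformalFactor

protected lemma id : IsConformalFactor g (fun x ↦ x) (fun _ ↦ 1) := by
  refine ⟨fun _ ↦ one_pos, fun x u v ↦ ?_⟩
  have mfderiv_eq : mfderiv 𝓘(ℝ, E) 𝓘(ℝ, E) (fun x : M ↦ x) x = ContinuousLinearMap.id ℝ _ :=
    mfderiv_id
  simp [mfderiv_eq]

protected lemma comp (h : IsConformalFactor g Φ Ω) (h' : IsConformalFactor g Ψ Ω')
    (hΦ : MDifferentiable 𝓘(ℝ, E) 𝓘(ℝ, E) Φ) (hΨ : MDifferentiable 𝓘(ℝ, E) 𝓘(ℝ, E) Ψ) :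
    IsConformalFactor g (fun x ↦ Φ (Ψ x)) (fun x ↦ Ω' x * Ω (Ψ x)) := by
  refine ⟨fun x ↦ mul_pos (h'.1 x) (h.1 _), fun x u v ↦ ?_⟩
  have chain_rule : mfderiv 𝓘(ℝ, E) 𝓘(ℝ, E) (fun x ↦ Φ (Ψ x)) x = _ :=
    mfderiv_comp x (hΦ (Ψ x)) (hΨ x)
  rw [chain_rule]
  exact (h.2 (Ψ x) _ _).trans ((congrArg (Ω (Ψ x) ^ 2 * ·) (h'.2 x u v)).trans (by ring))

protected lemma unique [Nontrivial E] (h : IsConformalFactor g Φ Ω)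
    (h' : IsConformalFactor g Φ Ω') : Ω = Ω' := by
  funext x
  obtain ⟨u, v, huv⟩ := exists_apply_apply_ne_zero (V := E) (g.nondegenerate x)
  have sq_eq := mul_right_cancel₀ huv ((h.2 x u v).symm.trans (h'.2 x u v))
  exact (sq_eq_sq₀ (h.1 x).le (h'.1 x).le).1 sq_eq

lemma inChart_apply (h : IsConformalFactor g Φ Ω) (hΦ : ContMDiff 𝓘(ℝ, E) 𝓘(ℝ, E) ∞ Φ)
    (he : e ∈ maximalAtlas 𝓘(ℝ, E) ∞ M) (he' : e' ∈ maximalAtlas 𝓘(ℝ, E) ∞ M)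
    (hy : y ∈ readInChartsDomain e e' Φ) (u v : E) :
    g.inChart e' (readInCharts e e' Φ y) (fderiv ℝ (readInCharts e e' Φ) y u)
      (fderiv ℝ (readInCharts e e' Φ) y v) = Ω (e.symm y) ^ 2 * g.inChart e y u v := by
  have chain_rule := mfderiv_symm_fderiv_readInCharts (hΦ.mdifferentiable (by simp))
    (mdifferentiable_of_mem_maximalAtlas he) (mdifferentiable_of_mem_maximalAtlas he') hy
  rw [PseudoRiemannianMetric.inChart_apply, PseudoRiemannianMetric.inChart_apply, ← h.2,
    chain_rule, chain_rule, symm_readInCharts hy]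

lemma contDiffOn_log_comp_symm (h : IsConformalFactor g Φ Ω)
    (hΩ : ContMDiff 𝓘(ℝ, E) 𝓘(ℝ, ℝ) ∞ Ω) (he : e ∈ maximalAtlas 𝓘(ℝ, E) ∞ M) :
    ContDiffOn ℝ ∞ (fun y ↦ Real.log (Ω (e.symm y))) (readInChartsDomain e e' Φ) :=
  ((contDiffOn_comp_symm hΩ he).mono Set.inter_subset_left).log fun _ _ ↦ (h.1 _).ne'

variable [FiniteDimensional ℝ E]

protected lemma contDiffOn_comp_symm [Nontrivial E] (h : IsConformalFactor g Φ Ω)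
    (hΦ : ContMDiff 𝓘(ℝ, E) 𝓘(ℝ, E) ∞ Φ) (he : e ∈ maximalAtlas 𝓘(ℝ, E) ∞ M)
    (he' : e' ∈ maximalAtlas 𝓘(ℝ, E) ∞ M) :
    ContDiffOn ℝ ∞ (Ω ∘ e.symm) (readInChartsDomain e e' Φ) := by
  intro y hy
  obtain ⟨u, v, huv⟩ := exists_apply_apply_ne_zero ((g.isMetricOn_inChart he).nondegenerate y hy.1)
  have domain_mem_nhds := (isOpen_readInChartsDomain hΦ.continuous).mem_nhds hy
  have metric_contDiffAt : ContDiffAt ℝ ∞ (fun z ↦ g.inChart e z u v) y :=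
    (g.contDiffOn_inChart_apply he u v).contDiffAt (e.open_target.mem_nhds hy.1)
  have pullback_contDiffAt := ((g.isMetricOn_inChart he').contDiffOn_pullback_apply
    (isOpen_readInChartsDomain hΦ.continuous) (contDiffOn_readInCharts hΦ he he')
    mapsTo_readInCharts u v).contDiffAt domain_mem_nhds
  have sq_contDiffAt : ContDiffAt ℝ ∞ (fun z ↦ Ω (e.symm z) ^ 2) y := by
    refine (pullback_contDiffAt.div metric_contDiffAt huv).congr_of_eventuallyEq ?_
    filter_upwards [domain_mem_nhds, metric_contDiffAt.continuousAt.eventually_ne huv] with z hz hne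
    rw [Pi.div_apply, h.inChart_apply hΦ he he' hz, mul_div_cancel_right₀ _ hne]
  have sqrt_contDiffAt := sq_contDiffAt.sqrt (pow_pos (h.1 _) 2).ne'
  simp only [Real.sqrt_sq (h.1 _).le] at sqrt_contDiffAt
  exact sqrt_contDiffAt.contDiffWithinAt

protected lemma contMDiff [Nontrivial E] (h : IsConformalFactor g Φ Ω)
    (hΦ : ContMDiff 𝓘(ℝ, E) 𝓘(ℝ, E) ∞ Φ) : ContMDiff 𝓘(ℝ, E) 𝓘(ℝ, ℝ) ∞ Ω := fun x ↦
  contMDiffAt_of_contDiffAt_comp_symm (chart_mem_maximalAtlas x) (mem_chart_source E x)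
    ((h.contDiffOn_comp_symm hΦ (chart_mem_maximalAtlas x)
      (chart_mem_maximalAtlas (Φ x))).contDiffAt ((isOpen_readInChartsDomain hΦ.continuous).mem_nhds
        (mem_readInChartsDomain (mem_chart_source E x) (mem_chart_source E (Φ x)))))

lemma isIsometryOn_inChart (h : IsConformalFactor g Φ Ω)
    (hΦ : ContMDiff 𝓘(ℝ, E) 𝓘(ℝ, E) ∞ Φ) (hΩ : ContMDiff 𝓘(ℝ, E) 𝓘(ℝ, ℝ) ∞ Ω)
    (he : e ∈ maximalAtlas 𝓘(ℝ, E) ∞ M) (he' : e' ∈ maximalAtlas 𝓘(ℝ, E) ∞ M) :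
    IsIsometryOn (conformal (fun y ↦ Real.log (Ω (e.symm y))) (g.inChart e))
      (readInChartsDomain e e' Φ) (g.inChart e') e'.target (readInCharts e e' Φ) where
  source := ((g.isMetricOn_inChart he).mono (isOpen_readInChartsDomain hΦ.continuous)
    Set.inter_subset_left).conformal (h.contDiffOn_log_comp_symm hΩ he)
  target := g.isMetricOn_inChart he'
  contDiffOn := contDiffOn_readInCharts hΦ he he'
  mapsTo := mapsTo_readInCharts
  apply_eq y hy u v := by
    rw [h.inChart_apply hΦ he he' hy, conformal, smul_apply, smul_apply, smul_eq_mul, two_mul,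
      Real.exp_add, Real.exp_log (h.1 _), sq]

end IsConformalFactor

namespace PseudoRiemannianMetric

variable [FiniteDimensional ℝ E] {f f₁ f₂ : M → ℂ} {x : M}

lemma yamabe_eq_localMetric_yamabe (g : PseudoRiemannianMetric E M) (f : M → ℂ) (x : M) :
    g.yamabe f x = LocalMetric.yamabe (g.inChart (chartAt E x)) (f ∘ (chartAt E x).symm)
      (chartAt E x x) := by
  simp [yamabe, LocalMetric.yamabe, laplacian, scalarCurvature, laplacian_eq_laplaceBeltrami]

lemma yamabe_eq_inChart (g : PseudoRiemannianMetric E M)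
    (hf : ContMDiff 𝓘(ℝ, E) 𝓘(ℝ, ℂ) ∞ f) (he : e ∈ maximalAtlas 𝓘(ℝ, E) ∞ M)
    (hx : x ∈ e.source) :
    g.yamabe f x = LocalMetric.yamabe (g.inChart e) (f ∘ e.symm) (e x) := by
  have he' := chart_mem_maximalAtlas (I := 𝓘(ℝ, E)) (n := ∞) x
  have isometry := (IsConformalFactor.id (g := g)).isIsometryOn_inChart contMDiff_id
    contMDiff_const he he'
  simp only [Real.log_one, conformal_zero] at isometry
  have hy : e x ∈ readInChartsDomain e (chartAt E x) fun z ↦ z :=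
    mem_readInChartsDomain hx (mem_chart_source E x)
  have f_eventuallyEq : f ∘ e.symm =ᶠ[nhds (e x)]
      (f ∘ (chartAt E x).symm) ∘ readInCharts e (chartAt E x) fun z ↦ z := by
    filter_upwards [(isOpen_readInChartsDomain continuous_id).mem_nhds hy] with z hz
    exact congrArg f (symm_readInCharts hz).symm
  rw [yamabe_congr f_eventuallyEq, isometry.yamabe_comp hy
    (contDiffAt_two_comp_symm hf he' (isometry.mapsTo hy)), yamabe_eq_localMetric_yamabe]
  simp only [readInCharts, Function.comp_apply, e.left_inv hx]

lemma contMDiff_yamabe (g : PseudoRiemannianMetric E M) (hf : ContMDiff 𝓘(ℝ, E) 𝓘(ℝ, ℂ) ∞ f) :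
    ContMDiff 𝓘(ℝ, E) 𝓘(ℝ, ℂ) ∞ (g.yamabe f) := by
  intro x
  have he := chart_mem_maximalAtlas (I := 𝓘(ℝ, E)) (n := ∞) x
  have hx := mem_chart_source E x
  have contDiffOn_chart : ContDiffOn ℝ ∞ (g.yamabe f ∘ (chartAt E x).symm) (chartAt E x).target :=
    ((g.isMetricOn_inChart he).contDiffOn_yamabe (contDiffOn_comp_symm hf he)).congr fun y hy ↦ by
      rw [Function.comp_apply, g.yamabe_eq_inChart hf he ((chartAt E x).map_target hy),
        (chartAt E x).right_inv hy]
  exact contMDiffAt_of_contDiffAt_comp_symm he hx (contDiffOn_chart.contDiffAt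
    ((chartAt E x).open_target.mem_nhds ((chartAt E x).map_source hx)))

lemma yamabe_add (h₁ : ContMDiff 𝓘(ℝ, E) 𝓘(ℝ, ℂ) ∞ f₁) (h₂ : ContMDiff 𝓘(ℝ, E) 𝓘(ℝ, ℂ) ∞ f₂)
    (x : M) : g.yamabe (f₁ + f₂) x = g.yamabe f₁ x + g.yamabe f₂ x := by
  have hy := (chartAt E x).map_source (mem_chart_source E x)
  simp only [yamabe_eq_localMetric_yamabe]
  exact LocalMetric.yamabe_add (contDiffAt_two_comp_symm h₁ (chart_mem_maximalAtlas x) hy)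
    (contDiffAt_two_comp_symm h₂ (chart_mem_maximalAtlas x) hy)

lemma yamabe_const_smul (g : PseudoRiemannianMetric E M) (c : ℂ) (f : M → ℂ) (x : M) :
    g.yamabe (c • f) x = c * g.yamabe f x := by
  simp only [yamabe_eq_localMetric_yamabe]
  exact LocalMetric.yamabe_const_smul c _

/-- The Yamabe operator as a linear endomorphism of `C^∞(M)`. -/
def yamabeLinearMap (g : PseudoRiemannianMetric E M) :
    SmoothFunctions E M →ₗ[ℂ] SmoothFunctions E M where
  toFun f := ⟨g.yamabe f.1, g.contMDiff_yamabe f.2⟩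
  map_add' f₁ f₂ := Subtype.ext (funext (yamabe_add f₁.2 f₂.2))
  map_smul' c f := Subtype.ext (funext (g.yamabe_const_smul c f.1))

end PseudoRiemannianMetric

lemma IsConformalFactor.yamabe_cpow_mul_comp [FiniteDimensional ℝ E]
    (hn : Module.finrank ℝ E ≠ 1) (h : IsConformalFactor g Φ Ω)
    (hΦ : ContMDiff 𝓘(ℝ, E) 𝓘(ℝ, E) ∞ Φ) (hΩ : ContMDiff 𝓘(ℝ, E) 𝓘(ℝ, ℝ) ∞ Ω)
    {f : M → ℂ} (hf : ContMDiff 𝓘(ℝ, E) 𝓘(ℝ, ℂ) ∞ f) (x : M) :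
    g.yamabe (fun z ↦ (Ω z : ℂ) ^ (((Module.finrank ℝ E : ℂ) - 2) / 2) * f (Φ z)) x =
      (Ω x : ℂ) ^ (((Module.finrank ℝ E : ℂ) + 2) / 2) * g.yamabe f (Φ x) := by
  have he := chart_mem_maximalAtlas (I := 𝓘(ℝ, E)) (n := ∞) x
  have he' := chart_mem_maximalAtlas (I := 𝓘(ℝ, E)) (n := ∞) (Φ x)
  have hx := mem_chart_source E x
  rw [g.yamabe_eq_localMetric_yamabe, g.yamabe_eq_localMetric_yamabe]
  generalize chartAt E x = e at he hx ⊢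
  have hx' := mem_chart_source E (Φ x)
  generalize chartAt E (Φ x) = e' at he' hx' ⊢
  have hy : e x ∈ readInChartsDomain e e' Φ := mem_readInChartsDomain hx hx'
  have domain_isOpen : IsOpen (readInChartsDomain e e' Φ) :=
    isOpen_readInChartsDomain hΦ.continuous
  have isometry := h.isIsometryOn_inChart hΦ hΩ he he'
  have f_contDiffAt : ContDiffAt ℝ 2 (f ∘ e'.symm) (readInCharts e e' Φ (e x)) :=
    contDiffAt_two_comp_symm hf he' (isometry.mapsTo hy)
  have f_eventuallyEq : (fun z ↦ (Ω z : ℂ) ^ (((Module.finrank ℝ E : ℂ) - 2) / 2) * f (Φ z)) ∘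
      e.symm =ᶠ[nhds (e x)] fun y ↦ Complex.exp (((Module.finrank ℝ E : ℂ) - 2) / 2 *
        (Real.log (Ω (e.symm y)) : ℝ)) * ((f ∘ e'.symm) ∘ readInCharts e e' Φ) y := by
    filter_upwards [domain_isOpen.mem_nhds hy] with y hy
    simp only [Function.comp_apply, ofReal_cpow_eq_exp (h.1 _), symm_readInCharts hy]
  rw [yamabe_congr f_eventuallyEq, ((g.isMetricOn_inChart he).mono domain_isOpen
    Set.inter_subset_left).yamabe_cexp_mul hn (σ := fun y ↦ Real.log (Ω (e.symm y)))
      (h.contDiffOn_log_comp_symm hΩ he) hy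
      (f_contDiffAt.comp _ ((isometry.contDiffAt hy).of_le ENat.LEInfty.out)),
    isometry.yamabe_comp hy f_contDiffAt, e.left_inv hx, ← ofReal_cpow_eq_exp (h.1 x)]
  simp only [readInCharts, Function.comp_apply, e.left_inv hx]

section Representation

/-- The operator `f ↦ Ω ^ lam * (f ∘ Φ)` on `C^∞(M)`. -/
def weightedPullback (hΦ : ContMDiff 𝓘(ℝ, E) 𝓘(ℝ, E) ∞ Φ) (hpos : ∀ x, 0 < Ω x)
    (hΩ : ContMDiff 𝓘(ℝ, E) 𝓘(ℝ, ℝ) ∞ Ω) (lam : ℂ) :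
    SmoothFunctions E M →ₗ[ℂ] SmoothFunctions E M where
  toFun f := ⟨fun x ↦ (Ω x : ℂ) ^ lam * f.1 (Φ x),
    (contDiff_mul (𝕜 := ℝ) (𝔸 := ℂ)).contMDiff.comp
      ((contMDiff_ofReal_cpow hpos hΩ lam).prodMk_space (ContMDiff.comp f.2 hΦ))⟩
  map_add' _ _ := Subtype.ext (funext fun _ ↦ mul_add _ _ _)
  map_smul' _ _ := Subtype.ext (funext fun _ ↦ mul_left_comm _ _ _)

variable [Nontrivial E] {G : Type*} [Group G] [MulAction G M] {Ω : G → M → ℝ}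

lemma conformalFactor_one (hΩ : ∀ h : G, IsConformalFactor g (fun x : M ↦ h • x) (Ω h)) (x : M) :
    Ω 1 x = 1 := by
  have one_factor := hΩ 1
  simp only [one_smul] at one_factor
  exact congrFun (one_factor.unique .id) x

lemma conformalFactor_mul
    (hsmooth : ∀ h : G, ContMDiff 𝓘(ℝ, E) 𝓘(ℝ, E) ∞ (fun x : M ↦ h • x))
    (hΩ : ∀ h : G, IsConformalFactor g (fun x : M ↦ h • x) (Ω h)) (h₁ h₂ : G) (x : M) :
    Ω (h₁ * h₂) x = Ω h₂ x * Ω h₁ (h₂ • x) := by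
  have mul_factor := hΩ (h₁ * h₂)
  simp only [mul_smul] at mul_factor
  exact congrFun (mul_factor.unique ((hΩ h₁).comp (hΩ h₂)
    ((hsmooth h₁).mdifferentiable (by simp)) ((hsmooth h₂).mdifferentiable (by simp)))) x

variable [FiniteDimensional ℝ E]

/-- The representation of a conformal group action on `C^∞(M)` twisted by the power `lam` of the
conformal factor. -/
def twistedRepresentation
    (hsmooth : ∀ h : G, ContMDiff 𝓘(ℝ, E) 𝓘(ℝ, E) ∞ (fun x : M ↦ h • x))
    (hΩ : ∀ h : G, IsConformalFactor g (fun x : M ↦ h • x) (Ω h)) (lam : ℂ) :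
    Representation ℂ G (SmoothFunctions E M) where
  toFun h := weightedPullback (hsmooth h⁻¹) (hΩ h⁻¹).1 ((hΩ h⁻¹).contMDiff (hsmooth h⁻¹)) lam
  map_one' := by
    ext f x
    simp [weightedPullback, conformalFactor_one hΩ]
  map_mul' h₁ h₂ := by
    ext f x
    simp only [weightedPullback, mul_inv_rev, conformalFactor_mul hsmooth hΩ, mul_smul,
      Complex.ofReal_mul]
    refine (congrArg (· * _) (Complex.mul_cpow_ofReal_nonneg ((hΩ _).1 _).le
      ((hΩ _).1 _).le lam)).trans (mul_assoc _ _ _)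

lemma twistedRepresentation_apply
    (hsmooth : ∀ h : G, ContMDiff 𝓘(ℝ, E) 𝓘(ℝ, E) ∞ (fun x : M ↦ h • x))
    (hΩ : ∀ h : G, IsConformalFactor g (fun x : M ↦ h • x) (Ω h)) (lam : ℂ) (h : G)
    (f : SmoothFunctions E M) (x : M) :
    (twistedRepresentation hsmooth hΩ lam h f).1 x = (Ω h⁻¹ x : ℂ) ^ lam * f.1 (h⁻¹ • x) := rfl

lemma yamabeLinearMap_twistedRepresentation (hn : Module.finrank ℝ E ≠ 1)
    (hsmooth : ∀ h : G, ContMDiff 𝓘(ℝ, E) 𝓘(ℝ, E) ∞ (fun x : M ↦ h • x))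
    (hΩ : ∀ h : G, IsConformalFactor g (fun x : M ↦ h • x) (Ω h)) (h : G)
    (f : SmoothFunctions E M) :
    g.yamabeLinearMap
        (twistedRepresentation hsmooth hΩ (((Module.finrank ℝ E : ℂ) - 2) / 2) h f) =
      twistedRepresentation hsmooth hΩ (((Module.finrank ℝ E : ℂ) + 2) / 2) h
        (g.yamabeLinearMap f) :=
  Subtype.ext (funext ((hΩ h⁻¹).yamabe_cpow_mul_comp hn (hsmooth h⁻¹)
    ((hΩ h⁻¹).contMDiff (hsmooth h⁻¹)) f.2))

end Representation

end

/-- `ϖ lam` is the twisted representation of `G` on `C^∞(M)` with parameter `lam`. -/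
theorem theorem2p5 {E : Type*} [NormedAddCommGroup E] [NormedSpace ℝ E] [FiniteDimensional ℝ E]
    (hn : 2 ≤ Module.finrank ℝ E)
    {M : Type*} [TopologicalSpace M] [ChartedSpace E M] [IsManifold 𝓘(ℝ, E) ∞ M]
    (g : PseudoRiemannianMetric E M)
    {G : Type*} [Group G] [MulAction G M]
    (hsmooth : ∀ h : G, ContMDiff 𝓘(ℝ, E) 𝓘(ℝ, E) ∞ (fun x : M ↦ h • x))
    (Ω : G → M → ℝ) (hΩ : ∀ h : G, IsConformalFactor g (fun x : M ↦ h • x) (Ω h)) :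
    ∃ (ϖ : ℂ → Representation ℂ G (SmoothFunctions E M))
      (D : Representation.IntertwiningMap
        (ϖ (((Module.finrank ℝ E : ℂ) - 2) / 2)) (ϖ (((Module.finrank ℝ E : ℂ) + 2) / 2)))
      (K : Subrepresentation (ϖ (((Module.finrank ℝ E : ℂ) - 2) / 2))),
      (∀ (lam : ℂ) (h : G) (f : SmoothFunctions E M) (x : M),
        (ϖ lam h⁻¹ f).1 x = (Ω h x : ℂ) ^ lam * f.1 (h • x)) ∧
      (∀ (f : SmoothFunctions E M) (x : M), (D f).1 x = g.yamabe f.1 x) ∧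
      (∀ f : SmoothFunctions E M, f ∈ K ↔ ∀ x : M, g.yamabe f.1 x = 0) := by
  have : Nontrivial E := Module.nontrivial_of_finrank_pos (R := ℝ) (by omega)
  let D := g.yamabeLinearMap.intertwiningMap_of_isIntertwiningMap _ _
    (yamabeLinearMap_twistedRepresentation (by omega) hsmooth hΩ)
  refine ⟨twistedRepresentation hsmooth hΩ, D, D.ker, fun lam h f x ↦ ?_, fun _ _ ↦ rfl,
    fun f ↦ ?_⟩
  · rw [twistedRepresentation_apply, inv_inv]
  · rw [Representation.IntertwiningMap.mem_ker, Subtype.ext_iff, funext_iff]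
    rfl
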